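/- **Theorem (Reisner).** Let $\Sigma$ be a simplicial complex on a finite vertex set $V$, i.e. a set of subsets of $V$ (the faces) that contains $\varnothing$ and $\{v\}$ for every $v\in V$ and is closed under taking subsets, and let $k$ be a field. Put $\dim\sigma=|\sigma|-1$ for a face $\sigma$, and let the dimension of a complex be the maximum of the dimensions of its faces (so $\dim\{\varnothing\}=-1$). For $\sigma\in\Sigma$ let $\operatorname{lk}\sigma=\{\tau\in\Sigma\mid \sigma\cap\tau=\varnothing,\ \sigma\cup\tau\in\Sigma\}$ be the link of $\sigma$. Let $k[\Sigma]=k[X_v\mid v\in V]/I$ be the face ring, where $I$ is the ideal generated by the monomials $\prod_{v\in s}X_v$ with $s\subseteq V$, $s\notin\Sigma$. Let $\tilde H_i(-,k)$ denote reduced simplicial homology, i.e. the homology of the augmented chain complex with coefficients in $k$, formed with respect to a total order of $V$, with the empty face in degree $-1$. Call a Noetherian ring Cohen–Macaulay if its localization at every maximal ideal has depth equal to its Krull dimension. Then $k[\Sigma]$ is Cohen–Macaulay if and only if $$\tilde H_i(\operatorname{lk}\sigma,k)=0\quad\text{for all }\sigma\in\Sigma\text{ and all } i<\dim(\operatorname{lk}\sigma),$$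 and $$\tilde H_i(\Sigma,k)=0\quad\text{for all } i<\dim\Sigma.$$ -/

import Mathlib

namespace Reisner

universe u v

section Complexes

variable {V : Type u}

/-- All faces of a simplicial complex, the empty face included. Mathlib's convention lists only the
nonempty faces of a complex; here the empty set is always a face (of dimension `-1`). -/
def faceSet (K : PreAbstractSimplicialComplex V) : Set (Finset V) :=
  insert ∅ K.faces

theorem mem_faceSet_of_subset (K : PreAbstractSimplicialComplex V) {s t : Finset V}
    (hs : s ∈ faceSet K) (hts : t ⊆ s) : t ∈ faceSet K := by
  rcases t.eq_empty_or_nonempty with rfl | ht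
  · exact Set.mem_insert _ _
  · rcases hs with rfl | hs
    · exact absurd (Finset.subset_empty.mp hts) ht.ne_empty
    · exact Or.inr ((K.isRelLowerSet_faces hs).2 hts ht)

open Classical in
/-- The dimension of a simplicial complex on a finite vertex set: the maximum over all faces
(including the empty one) of the number of vertices minus one. It is `-1` if `∅` is the only
face. -/
noncomputable def dim [Fintype V] (K : PreAbstractSimplicialComplex V) : ℤ :=
  (((Finset.univ.filter (fun s : Finset V => s ∈ faceSet K)).sup Finset.card : ℕ) : ℤ) - 1

/-- The link of `σ`: the complex whose faces, the empty one included if `σ` is a face, are the `τ`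
disjoint from `σ` such that `σ ∪ τ` is a face. -/
def link [DecidableEq V] (K : PreAbstractSimplicialComplex V) (σ : Finset V) :
    PreAbstractSimplicialComplex V where
  faces := {τ | τ.Nonempty ∧ Disjoint σ τ ∧ σ ∪ τ ∈ faceSet K}
  isRelLowerSet_faces := fun {_} h =>
    ⟨h.1, fun _ hts ht => ⟨ht, h.2.1.mono_right hts,
      mem_faceSet_of_subset K h.2.2 (Finset.union_subset_union_right hts)⟩⟩

end Complexes

section FaceRing

variable {V : Type u}

/-- The ideal generated by the monomials `∏ i ∈ s, X i` with `s` not a face. -/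
noncomputable def nonfaceIdeal (k : Type v) [CommRing k] (K : PreAbstractSimplicialComplex V) :
    Ideal (MvPolynomial V k) :=
  Ideal.span {p | ∃ s : Finset V, s ∉ faceSet K ∧ p = ∏ i ∈ s, MvPolynomial.X i}

/-- The face ring (Stanley–Reisner ring) `k[K]`. -/
abbrev FaceRing (k : Type v) [CommRing k] (K : PreAbstractSimplicialComplex V) : Type (max u v) :=
  MvPolynomial V k ⧸ nonfaceIdeal k K

end FaceRing

section CohenMacaulay

/-- The depth of a local ring: the supremum of the lengths of the regular sequences contained in the
maximal ideal. -/
noncomputable def localDepth (A : Type u) [CommRing A] [IsLocalRing A] : ℕ∞ :=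
  ⨆ rs : {rs : List A // RingTheory.Sequence.IsRegular A rs ∧
    ∀ r ∈ rs, r ∈ IsLocalRing.maximalIdeal A}, (rs.1.length : ℕ∞)

/-- A commutative ring is Cohen–Macaulay if it is Noetherian and its localization at every maximal
ideal has depth equal to its Krull dimension. -/
structure IsCohenMacaulay (A : Type u) [CommRing A] : Prop where
  isNoetherianRing : IsNoetherianRing A
  depth_eq_dim : ∀ (M : Ideal A) [M.IsMaximal],
    (localDepth (Localization.AtPrime M) : WithBot ℕ∞) = ringKrullDim (Localization.AtPrime M)

end CohenMacaulay

section Homology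

variable {V : Type u} [LinearOrder V]

/-- The module of `i`-chains, `i : ℤ`: the free module on the faces with `i + 1` vertices. It is
free of rank one for `i = -1` and zero for `i < -1`. -/
abbrev Chains (k : Type v) [CommRing k] (K : PreAbstractSimplicialComplex V) (i : ℤ) :
    Type (max u v) :=
  {s : Finset V // s ∈ faceSet K ∧ (s.card : ℤ) = i + 1} →₀ k

open Classical in
/-- The basis element of `Chains k K i` given by `t`, or `0` if `t` is not an `i`-dimensional
face. -/
noncomputable def basisChain (k : Type v) [CommRing k] (K : PreAbstractSimplicialComplex V) (i : ℤ)
    (t : Finset V) : Chains k K i :=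
  if h : t ∈ faceSet K ∧ (t.card : ℤ) = i + 1 then Finsupp.single ⟨t, h⟩ 1 else 0

/-- The boundary of the `i`-face `s`, in degree `j`. For `v` the `m`-th vertex of `s` (counted from
`0` in increasing order), `s.erase v` occurs with sign `(-1) ^ m`. The sum is zero unless
`j + 1 = i`. -/
noncomputable def boundary (k : Type v) [CommRing k] (K : PreAbstractSimplicialComplex V)
    (i j : ℤ) : Chains k K i →ₗ[k] Chains k K j :=
  Finsupp.linearCombination k fun s =>
    ∑ v ∈ s.1, (-1 : k) ^ (s.1.filter (· < v)).card • basisChain k K j (s.1.erase v)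

theorem boundary_basisChain (k : Type v) [CommRing k] (K : PreAbstractSimplicialComplex V)
    (i j : ℤ) (t : Finset V) (ht : t ∈ faceSet K) (hc : (t.card : ℤ) = i + 1) :
    boundary k K i j (basisChain k K i t) =
      ∑ v ∈ t, (-1 : k) ^ (t.filter (· < v)).card • basisChain k K j (t.erase v) := by
  rw [basisChain, dif_pos ⟨ht, hc⟩, boundary, Finsupp.linearCombination_single, one_smul]

theorem boundary_shape (k : Type v) [CommRing k] (K : PreAbstractSimplicialComplex V)
    (i j : ℤ) (h : j + 1 ≠ i) : boundary k K i j = 0 := by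
  ext1 s
  ext1
  simp only [boundary, LinearMap.comp_apply, Finsupp.lsingle_apply,
    Finsupp.linearCombination_single, one_smul, LinearMap.zero_apply]
  refine Finset.sum_eq_zero fun v hv => ?_
  rw [basisChain, dif_neg, smul_zero]
  rintro ⟨-, h2⟩
  have h3 := Finset.card_erase_add_one hv
  have h4 := s.2.2
  omega

theorem boundary_comp (k : Type v) [CommRing k] (K : PreAbstractSimplicialComplex V)
    (i j l : ℤ) (hij : j + 1 = i) : boundary k K j l ∘ₗ boundary k K i j = 0 := by
  ext1 s
  ext1
  obtain ⟨s, hs, hc⟩ := s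
  simp only [LinearMap.comp_apply, Finsupp.lsingle_apply, LinearMap.zero_apply]
  have e : boundary k K i j (Finsupp.single ⟨s, hs, hc⟩ 1) =
      ∑ v ∈ s, (-1 : k) ^ (s.filter (· < v)).card • basisChain k K j (s.erase v) := by
    simp [boundary]
  rw [e, map_sum]
  have e2 : ∀ v ∈ s, boundary k K j l
      ((-1 : k) ^ (s.filter (· < v)).card • basisChain k K j (s.erase v)) =
      ∑ w ∈ s.erase v, ((-1 : k) ^ (s.filter (· < v)).card *
        (-1 : k) ^ ((s.erase v).filter (· < w)).card) •
        basisChain k K l ((s.erase v).erase w) := by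
    intro v hv
    have h3 := Finset.card_erase_add_one hv
    rw [map_smul, boundary_basisChain k K j l (s.erase v)
      (mem_faceSet_of_subset K hs (Finset.erase_subset _ _)) (by omega), Finset.smul_sum]
    simp only [smul_smul]
  rw [Finset.sum_congr rfl e2, Finset.sum_sigma']
  have key : ∀ v w, v ∈ s → w ∈ s → v < w →
      (-1 : k) ^ (s.filter (· < v)).card * (-1 : k) ^ ((s.erase v).filter (· < w)).card +
      (-1 : k) ^ (s.filter (· < w)).card * (-1 : k) ^ ((s.erase w).filter (· < v)).card = 0 := by
    intro v w hv hw hvw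
    have h1 : ((s.erase v).filter (· < w)).card + 1 = (s.filter (· < w)).card := by
      rw [Finset.filter_erase]
      exact Finset.card_erase_add_one (by simp [hv, hvw])
    have h2 : ((s.erase w).filter (· < v)) = s.filter (· < v) := by
      rw [Finset.filter_erase]
      exact Finset.erase_eq_of_notMem (by simp [hvw.le])
    rw [h2, ← h1, pow_succ]
    ring
  refine Finset.sum_involution (fun p _ => ⟨p.2, p.1⟩) ?_ ?_ ?_ ?_
  · rintro ⟨v, w⟩ hp
    simp only [Finset.mem_sigma, Finset.mem_erase] at hp
    rw [Finset.erase_right_comm, ← add_smul]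
    rcases lt_or_gt_of_ne hp.2.1 with h | h
    · rw [add_comm ((-1 : k) ^ _ * _), key w v hp.2.2 hp.1 h, zero_smul]
    · rw [key v w hp.1 hp.2.2 h, zero_smul]
  · rintro ⟨v, w⟩ hp - h
    simp only [Finset.mem_sigma, Finset.mem_erase] at hp
    simp only [Sigma.mk.injEq] at h
    exact hp.2.1 h.1
  · rintro ⟨v, w⟩ hp
    simp only [Finset.mem_sigma, Finset.mem_erase] at hp ⊢
    exact ⟨hp.2.2, hp.2.1.symm, hp.1⟩
  · rintro ⟨v, w⟩ hp
    rfl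

/-- The augmented oriented chain complex of `K` with coefficients in `k`, indexed by `ℤ`, with the
empty face in degree `-1`. -/
noncomputable def augmentedChainComplex (k : Type v) [CommRing k]
    (K : PreAbstractSimplicialComplex V) : ChainComplex (ModuleCat.{max u v} k) ℤ where
  X i := ModuleCat.of k (Chains k K i)
  d i j := ModuleCat.ofHom (boundary k K i j)
  shape i j h := by
    rw [boundary_shape k K i j h]
    rfl
  d_comp_d' i j l hij _ := by
    rw [← ModuleCat.ofHom_comp, boundary_comp k K i j l hij]
    rfl

/-- The reduced simplicial homology of `K` in degree `i` with coefficients in `k`. -/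
noncomputable def reducedHomology (k : Type v) [CommRing k] (K : PreAbstractSimplicialComplex V)
    (i : ℤ) : ModuleCat.{max u v} k :=
  (augmentedChainComplex k K).homology i

end Homology

end Reisner

/-!
A Koszul cochain of the variables with values in `k[Σ]` decomposes by multidegree: a squarefree
component is, up to signs, a simplicial cochain of a deletion of `Σ`, and a component with some
exponent at least two is contractible. Hence the Koszul cohomology of the variables vanishes below
degree `d` if and only if the deletion of every vertex set `G` is acyclic below `d - |G|`.
Contracting cochains against a vertex trades deletions for links, so this is the condition of the
theorem; since Koszul cohomology measures depth, it settles the irrelevant maximal ideal.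

Let now `M` be a maximal ideal which does not contain the class of some `X v`. By Zariski's lemma
there is a monic `f` with `f(X v) ∈ M`. Locally at `M` the element `f(X v)` is regular, and the
quotient by it is the face ring of the link of `v` with coefficients in `k[T]/(f)`, so a regular
sequence of the expected length exists at `M` by induction. As `k[T]/(f)` need not be a field, the
induction is over face rings with coefficients in arbitrary Noetherian `k`-algebras.
-/

namespace Reisner

universe u v

open Finset

/-! ### Koszul cochains -/

section Koszul

variable {V : Type*} [LinearOrder V] {R : Type*} [CommRing R] {N : Type*} [AddCommGroup N]
  [Module R N]

variable (R) in
/-- The sign of `v` relative to `F`: the parity of the number of elements of `F` preceding `v`. -/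
def koszulSign (v : V) (F : Finset V) : R := (-1) ^ #{w ∈ F | w < v}

@[simp]
theorem koszulSign_mul_self (v : V) (F : Finset V) : koszulSign R v F * koszulSign R v F = 1 := by
  rw [koszulSign, ← mul_pow]
  simp

theorem isUnit_koszulSign (v : V) (F : Finset V) : IsUnit (koszulSign R v F) :=
  isUnit_one.neg.pow _

@[simp]
theorem koszulSign_erase_self (v : V) (F : Finset V) :
    koszulSign R v (F.erase v) = koszulSign R v F := by
  rw [koszulSign, filter_erase, erase_eq_of_notMem (by simp), koszulSign]

@[simp]
theorem koszulSign_insert_self (v : V) (F : Finset V) :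
    koszulSign R v (insert v F) = koszulSign R v F := by
  rw [koszulSign, filter_insert, if_neg (lt_irrefl v), koszulSign]

theorem koszulSign_insert_of_lt {v w : V} {F : Finset V} (hv : v ∉ F) (h : v < w) :
    koszulSign R w (insert v F) = -koszulSign R w F := by
  rw [koszulSign, filter_insert, if_pos h, card_insert_of_notMem (by simp [hv]), pow_succ,
    mul_neg_one, koszulSign]

theorem koszulSign_insert_of_gt {v w : V} {F : Finset V} (h : w < v) :
    koszulSign R w (insert v F) = koszulSign R w F := by
  rw [koszulSign, filter_insert, if_neg h.not_gt, koszulSign]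

theorem koszulSign_insert_mul {v w : V} {F : Finset V} (hv : v ∉ F) (hw : w ∈ F) :
    koszulSign R w (insert v F) * koszulSign R v F =
      -(koszulSign R w F * koszulSign R v (F.erase w)) := by
  obtain ⟨G, hwG, rfl⟩ : ∃ G, w ∉ G ∧ insert w G = F :=
    ⟨F.erase w, notMem_erase w F, insert_erase hw⟩
  rw [mem_insert, not_or] at hv
  rw [insert_comm v w, koszulSign_insert_self, erase_insert hwG]
  rcases lt_or_gt_of_ne hv.1 with h | h
  · rw [koszulSign_insert_of_lt hv.2 h, koszulSign_insert_of_gt h, koszulSign_insert_self, neg_mul]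
  · rw [koszulSign_insert_of_lt hwG h, koszulSign_insert_of_gt h, koszulSign_insert_self, mul_neg]

theorem map_koszulSign {S : Type*} [CommRing S] (φ : R →+* S) (v : V) (F : Finset V) :
    φ (koszulSign R v F) = koszulSign S v F := by
  simp [koszulSign]

/-- The Koszul differential of the family `x` with coefficients in `N`. Cochains are functions on
the finite subsets of the index set, those of degree `n` being the functions on the subsets with
`n` elements; all degrees are treated at once. -/
def koszulD (x : V → R) : (Finset V → N) →ₗ[R] (Finset V → N) where
  toFun c F := ∑ v ∈ F, (koszulSign R v F * x v) • c (F.erase v)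
  map_add' c c' := by
    ext F
    simp [smul_add, sum_add_distrib]
  map_smul' r c := by
    ext F
    simp only [Pi.smul_apply, RingHom.id_apply, smul_sum]
    exact sum_congr rfl fun v _ => smul_comm _ _ _

theorem koszulD_apply (x : V → R) (c : Finset V → N) (F : Finset V) :
    koszulD x c F = ∑ v ∈ F, (koszulSign R v F * x v) • c (F.erase v) := rfl

theorem koszulD_congr (x : V → R) {c c' : Finset V → N} {F : Finset V}
    (h : ∀ v ∈ F, c (F.erase v) = c' (F.erase v)) : koszulD x c F = koszulD x c' F :=
  sum_congr rfl fun v hv => by rw [h v hv]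

theorem koszulD_map {N' : Type*} [AddCommGroup N'] [Module R N'] (f : N →ₗ[R] N') (x : V → R)
    (c : Finset V → N) (F : Finset V) : koszulD x (fun G => f (c G)) F = f (koszulD x c F) := by
  simp [koszulD_apply]

theorem koszulD_ringHom {S : Type*} [CommRing S] (φ : R →+* S) (x : V → R) (c : Finset V → R)
    (F : Finset V) : koszulD (fun v => φ (x v)) (fun G => φ (c G)) F = φ (koszulD x c F) := by
  simp [koszulD_apply, map_koszulSign]

theorem koszulD_mem (x : V → R) (P : Submodule R N) {c : Finset V → N} {F : Finset V}
    (h : ∀ v ∈ F, c (F.erase v) ∈ P) : koszulD x c F ∈ P :=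
  P.sum_mem fun v hv => P.smul_mem _ (h v hv)

variable (R) in
/-- Contraction of cochains with the basis vector of index `v`, the homotopy between multiplication
by `x v` and zero on the Koszul complex of `x`. -/
def contract (v : V) : (Finset V → N) →ₗ[R] (Finset V → N) where
  toFun c F := if v ∈ F then 0 else koszulSign R v F • c (insert v F)
  map_add' c c' := by
    ext F
    by_cases h : v ∈ F <;> simp [h]
  map_smul' r c := by
    ext F
    by_cases h : v ∈ F
    · simp [h]
    · simpa [h] using smul_comm _ _ _

theorem contract_of_mem {v : V} {F : Finset V} (h : v ∈ F) (c : Finset V → N) :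
    contract R v c F = 0 := if_pos h

theorem contract_of_notMem {v : V} {F : Finset V} (h : v ∉ F) (c : Finset V → N) :
    contract R v c F = koszulSign R v F • c (insert v F) := if_neg h

theorem koszulSign_smul_contract_erase {v : V} {F : Finset V} (h : v ∈ F) (c : Finset V → N) :
    koszulSign R v F • contract R v c (F.erase v) = c F := by
  rw [contract_of_notMem (notMem_erase v F), insert_erase h, koszulSign_erase_self, smul_smul,
    koszulSign_mul_self, one_smul]

theorem contract_koszulD (x : V → R) (v : V) (c : Finset V → N) (F : Finset V) :
    contract R v (koszulD x c) F + koszulD x (contract R v c) F = x v • c F := by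
  by_cases h : v ∈ F
  · rw [contract_of_mem h, zero_add, koszulD_apply, sum_eq_single_of_mem v h, mul_comm,
      mul_smul, koszulSign_smul_contract_erase h]
    intro w _ hwv
    rw [contract_of_mem (mem_erase.mpr ⟨hwv.symm, h⟩), smul_zero]
  · have cancel : ∀ w ∈ F,
        koszulSign R v F • (koszulSign R w (insert v F) * x w) • c ((insert v F).erase w) +
          (koszulSign R w F * x w) • contract R v c (F.erase w) = 0 := fun w hw => by
      have hvw : v ≠ w := fun e => h (e ▸ hw)
      have hv : v ∉ F.erase w := fun h' => h (mem_of_mem_erase h')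
      rw [contract_of_notMem hv, erase_insert_of_ne hvw, smul_smul, smul_smul, ← add_smul]
      convert! zero_smul R _
      linear_combination x w * koszulSign_insert_mul (R := R) h hw
    rw [contract_of_notMem h, koszulD_apply, sum_insert h, smul_add, smul_smul, erase_insert h,
      koszulSign_insert_self, ← mul_assoc, koszulSign_mul_self, one_mul, add_assoc, smul_sum,
      koszulD_apply, ← sum_add_distrib, sum_eq_zero cancel, add_zero]

theorem koszulD_insert (x : V → R) {v : V} {F : Finset V} (h : v ∉ F) (c : Finset V → N) :
    koszulD x c (insert v F) = koszulSign R v F •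
      (x v • c F - koszulD x (contract R v c) F) := by
  rw [← contract_koszulD, add_sub_cancel_right, contract_of_notMem h, smul_smul,
    koszulSign_mul_self, one_smul]

theorem koszulD_koszulD (x : V → R) (c : Finset V → N) (F : Finset V) :
    koszulD x (koszulD x c) F = 0 := by
  induction F using Finset.induction_on generalizing c with
  | empty => simp [koszulD_apply]
  | insert v F h ih =>
    have anticommute : contract R v (koszulD x c) = x v • c - koszulD x (contract R v c) :=
      funext fun G => eq_sub_of_add_eq (contract_koszulD x v c G)
    rw [koszulD_insert x h, anticommute, map_sub, map_smul, Pi.sub_apply, ih, sub_zero,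
      Pi.smul_apply, sub_self, smul_zero]

end Koszul

/-! ### Links, deletions and simplicial cochains -/

section LinkDeletion

variable {V : Type*} {Δ : Set (Finset V)}

/-- The deletion of `G` from a family `Δ` of finite sets: the members of `Δ` which avoid `G`. -/
def del (Δ : Set (Finset V)) (G : Finset V) : Set (Finset V) := {F | Disjoint G F ∧ F ∈ Δ}

theorem mem_del {F G : Finset V} : F ∈ del Δ G ↔ Disjoint G F ∧ F ∈ Δ := Iff.rfl

theorem mem_del_singleton {v : V} {F : Finset V} : F ∈ del Δ {v} ↔ v ∉ F ∧ F ∈ Δ := by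
  simp [mem_del]

theorem isLowerSet_del (h : IsLowerSet Δ) (G : Finset V) : IsLowerSet (del Δ G) :=
  fun _ _ hle hF => ⟨hF.1.mono_right hle, h hle hF.2⟩

@[simp]
theorem del_empty : del Δ ∅ = Δ := by simp [del]

variable [DecidableEq V] {v : V} {F G H : Finset V}

theorem del_del_singleton : del (del Δ H) {v} = del Δ (insert v H) := by
  ext F
  simp only [mem_del, disjoint_singleton_left, disjoint_insert_left, and_assoc]

/-- The link of `G` in a family `Δ` of finite sets. It is empty if `Δ` is a lower set and `G` is not
a member of `Δ`, so that statements on links need not assume that `G` is a face. -/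
def lk (Δ : Set (Finset V)) (G : Finset V) : Set (Finset V) := {F | Disjoint G F ∧ G ∪ F ∈ Δ}

theorem mem_lk : F ∈ lk Δ G ↔ Disjoint G F ∧ G ∪ F ∈ Δ := Iff.rfl

theorem mem_lk_singleton : F ∈ lk Δ {v} ↔ v ∉ F ∧ insert v F ∈ Δ := by
  simp [mem_lk]

theorem erase_mem_lk_singleton (hv : v ∈ F) (hF : F ∈ Δ) : F.erase v ∈ lk Δ {v} :=
  mem_lk_singleton.mpr ⟨notMem_erase v F, by rwa [insert_erase hv]⟩

theorem isLowerSet_lk (h : IsLowerSet Δ) (G : Finset V) : IsLowerSet (lk Δ G) :=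
  fun _ _ hle hF => ⟨hF.1.mono_right hle, h (union_subset_union_right hle) hF.2⟩

theorem lk_subset (h : IsLowerSet Δ) (G : Finset V) : lk Δ G ⊆ Δ :=
  fun _ hF => h subset_union_right hF.2

theorem lk_eq_empty (h : IsLowerSet Δ) (hG : G ∉ Δ) : lk Δ G = ∅ :=
  Set.eq_empty_of_forall_notMem fun _ hF => hG (h subset_union_left hF.2)

@[simp]
theorem lk_empty : lk Δ ∅ = Δ := by simp [lk]

theorem lk_lk_singleton (hv : v ∉ G) : lk (lk Δ {v}) G = lk Δ (insert v G) := by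
  ext F
  simp only [mem_lk, disjoint_singleton_left, singleton_union, mem_union, insert_union,
    disjoint_insert_left]
  tauto

theorem lk_del_lk_singleton (hG : v ∉ G) (hH : v ∉ H) :
    lk (del (lk Δ G) H) {v} = del (lk Δ (insert v G)) H := by
  ext F
  simp only [mem_lk, mem_del, disjoint_singleton_left, singleton_union, disjoint_insert_left,
    disjoint_insert_right, union_insert, insert_union]
  tauto

end LinkDeletion

section Acyclic

variable {V : Type*} [LinearOrder V] {Δ : Set (Finset V)} {L : Type*} [CommRing L] {v : V}
  {F : Finset V} {n : ℕ}

/-- Vanishing of the reduced simplicial cohomology of `Δ` with coefficients in `L` at the faces with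
`n` vertices, that is, in degree `n - 1`. Cochains are defined on all finite sets and only their
values on members of `Δ` matter; the coboundary is the Koszul differential of the constant family
`1`. -/
def AcyclicAt (L : Type*) [CommRing L] (Δ : Set (Finset V)) (n : ℕ) : Prop :=
  ∀ c : Finset V → L, (∀ F ∈ Δ, #F = n + 1 → koszulD (1 : V → L) c F = 0) →
    ∃ b : Finset V → L, ∀ F ∈ Δ, #F = n → koszulD (1 : V → L) b F = c F

theorem acyclicAt_empty (L : Type*) [CommRing L] (n : ℕ) :
    AcyclicAt L (∅ : Set (Finset V)) n :=
  fun _ _ => ⟨0, fun _ h => absurd h (Set.notMem_empty _)⟩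

theorem koszulD_one_insert (h : v ∉ F) (c : Finset V → L) :
    koszulD (1 : V → L) c (insert v F) =
      koszulSign L v F * (c F - koszulD (1 : V → L) (contract L v c) F) := by
  simpa using koszulD_insert (1 : V → L) h c

theorem koszulD_one_singleton (c : Finset V → L) (v : V) :
    koszulD (1 : V → L) c {v} = c ∅ := by
  simp [koszulD_apply, koszulSign, filter_singleton]

theorem koszulD_one_pair (c : Finset V → L) {v w : V} (h : v ≠ w) :
    koszulD (1 : V → L) c {v, w} = koszulSign L v {w} * (c {w} - c {v}) := by
  rw [koszulD_one_insert (notMem_singleton.mpr h), koszulD_one_singleton,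
    contract_of_notMem (notMem_empty v)]
  simp [koszulSign]

/-- The cochain which is `b` on the sets avoiding `v`, and whose contraction with `v` is `c`. -/
def glue (v : V) (b c : Finset V → L) (F : Finset V) : L :=
  if v ∈ F then koszulSign L v F * c (F.erase v) else b F

theorem glue_of_notMem (h : v ∉ F) (b c : Finset V → L) : glue v b c F = b F := if_neg h

theorem glue_insert (h : v ∉ F) (b c : Finset V → L) :
    glue v b c (insert v F) = koszulSign L v F * c F := by
  rw [glue, if_pos (mem_insert_self _ _), erase_insert h, koszulSign_insert_self]

theorem contract_glue (h : v ∉ F) (b c : Finset V → L) : contract L v (glue v b c) F = c F := by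
  rw [contract_of_notMem h, glue_insert h, smul_eq_mul, ← mul_assoc, koszulSign_mul_self, one_mul]

theorem koszulD_glue_of_notMem (h : v ∉ F) (b c : Finset V → L) :
    koszulD (1 : V → L) (glue v b c) F = koszulD (1 : V → L) b F :=
  koszulD_congr _ fun _ _ => glue_of_notMem (fun h' => h (mem_of_mem_erase h')) _ _

theorem koszulD_glue_insert (h : v ∉ F) (b c : Finset V → L) :
    koszulD (1 : V → L) (glue v b c) (insert v F) =
      koszulSign L v F * (b F - koszulD (1 : V → L) c F) := by
  rw [koszulD_one_insert h, glue_of_notMem h]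
  congr 2
  exact koszulD_congr _ fun _ _ => contract_glue (fun h' => h (mem_of_mem_erase h')) _ _

theorem koszulD_glue_eq_zero {b c : Finset V → L}
    (hb : ∀ F ∈ del Δ {v}, #F = n + 1 → koszulD (1 : V → L) b F = 0)
    (hc : ∀ F ∈ lk Δ {v}, #F = n → koszulD (1 : V → L) c F = b F) :
    ∀ F ∈ Δ, #F = n + 1 → koszulD (1 : V → L) (glue v b c) F = 0 := by
  intro F hF hn
  by_cases hv : v ∈ F
  · rw [← insert_erase hv, koszulD_glue_insert (notMem_erase v F),
      hc _ (erase_mem_lk_singleton hv hF) (by rw [card_erase_of_mem hv, hn, Nat.add_sub_cancel]),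
      sub_self, mul_zero]
  · rw [koszulD_glue_of_notMem hv]
    exact hb F (mem_del_singleton.mpr ⟨hv, hF⟩) hn

theorem AcyclicAt.del_singleton (hΔ : IsLowerSet Δ) (h : AcyclicAt L Δ n)
    (hlk : AcyclicAt L (lk Δ {v}) n) : AcyclicAt L (del Δ {v}) n := by
  intro c hc
  obtain ⟨b, hb⟩ := hlk c fun F hF hn => hc F
    (mem_del_singleton.mpr ⟨(mem_lk_singleton.mp hF).1, lk_subset hΔ _ hF⟩) hn
  obtain ⟨e, he⟩ := h (glue v c b) (koszulD_glue_eq_zero hc hb)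
  refine ⟨e, fun F hF hn => ?_⟩
  obtain ⟨hv, hF⟩ := mem_del_singleton.mp hF
  rw [he F hF hn, glue_of_notMem hv]

theorem AcyclicAt.lk_singleton (hΔ : IsLowerSet Δ) (h : AcyclicAt L Δ (n + 1))
    (hdel : AcyclicAt L (del Δ {v}) n) : AcyclicAt L (lk Δ {v}) n := by
  intro c hc
  obtain ⟨b, hb⟩ := h (glue v 0 c) (koszulD_glue_eq_zero (by simp) hc)
  obtain ⟨e, he⟩ := hdel b fun F hF hn => by
    obtain ⟨hv, hF⟩ := mem_del_singleton.mp hF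
    rw [hb F hF hn, glue_of_notMem hv, Pi.zero_apply]
  refine ⟨e - contract L v b, fun F hF hn => ?_⟩
  obtain ⟨hv, hF'⟩ := mem_lk_singleton.mp hF
  have hbc := hb (insert v F) hF' (by rw [card_insert_of_notMem hv, hn])
  rw [koszulD_one_insert hv, glue_insert hv] at hbc
  rw [map_sub, Pi.sub_apply, he F (mem_del_singleton.mpr ⟨hv, lk_subset hΔ _ hF⟩) hn]
  exact (isUnit_koszulSign v F).mul_left_cancel hbc

theorem acyclicAt_del_lk_of_forall_lk (hΔ : IsLowerSet Δ) {d : ℕ}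
    (h : ∀ (G : Finset V) (n : ℕ), n + #G < d → AcyclicAt L (lk Δ G) n) (H : Finset V) :
    ∀ (G : Finset V) (n : ℕ), Disjoint G H → n + #G + #H < d →
      AcyclicAt L (del (lk Δ G) H) n := by
  induction H using Finset.induction_on with
  | empty =>
    intro G n _ hn
    rw [del_empty]
    exact h G n hn
  | insert v H hv ih =>
    intro G n hGH hn
    rw [card_insert_of_notMem hv] at hn
    obtain ⟨hvG, hGH⟩ := disjoint_insert_right.mp hGH
    rw [← del_del_singleton]
    refine .del_singleton (isLowerSet_del (isLowerSet_lk hΔ _) _) (ih G n hGH (by omega)) ?_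
    rw [lk_del_lk_singleton hvG hv]
    refine ih _ n (disjoint_insert_left.mpr ⟨hv, hGH⟩) ?_
    rw [card_insert_of_notMem hvG]
    omega

theorem acyclicAt_del_lk_of_forall_del (hΔ : IsLowerSet Δ) {d : ℕ}
    (h : ∀ (H : Finset V) (n : ℕ), n + #H < d → AcyclicAt L (del Δ H) n) (G : Finset V) :
    ∀ (H : Finset V) (n : ℕ), Disjoint G H → n + #G + #H < d →
      AcyclicAt L (del (lk Δ G) H) n := by
  induction G using Finset.induction_on with
  | empty =>
    intro H n _ hn
    rw [lk_empty]
    exact h H n hn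
  | insert v G hv ih =>
    intro H n hGH hn
    rw [card_insert_of_notMem hv] at hn
    obtain ⟨hvH, hGH⟩ := disjoint_insert_left.mp hGH
    rw [← lk_del_lk_singleton hv hvH]
    refine .lk_singleton (isLowerSet_del (isLowerSet_lk hΔ _) _) (ih H (n + 1) hGH (by omega)) ?_
    rw [del_del_singleton]
    refine ih _ n (disjoint_insert_right.mpr ⟨hv, hGH⟩) ?_
    rw [card_insert_of_notMem hvH]
    omega

theorem forall_acyclicAt_lk_iff_forall_acyclicAt_del (hΔ : IsLowerSet Δ) (d : ℕ) :
    (∀ (G : Finset V) (n : ℕ), n + #G < d → AcyclicAt L (lk Δ G) n) ↔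
      ∀ (H : Finset V) (n : ℕ), n + #H < d → AcyclicAt L (del Δ H) n := by
  refine ⟨fun h H n hn => ?_, fun h G n hn => ?_⟩
  · simpa only [lk_empty] using
      acyclicAt_del_lk_of_forall_lk hΔ h H ∅ n (disjoint_empty_left H) (by simpa using hn)
  · simpa only [del_empty] using
      acyclicAt_del_lk_of_forall_del hΔ h G ∅ n (disjoint_empty_right G) (by simpa using hn)

/-- Every link has vanishing reduced cohomology below its dimension. -/
def LinksAcyclic (L : Type*) [CommRing L] (Δ : Set (Finset V)) : Prop :=
  ∀ G ∈ Δ, ∀ F ∈ lk Δ G, ∀ n < #F, AcyclicAt L (lk Δ G) n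

theorem LinksAcyclic.lk_singleton (h : LinksAcyclic L Δ) (v : V) :
    LinksAcyclic L (lk Δ {v}) := by
  intro G hG
  obtain ⟨hv, hG⟩ := mem_lk_singleton.mp hG
  rw [lk_lk_singleton hv]
  exact h _ hG

/-- Every member of `Δ` lies in one with `d` elements; if no member of the lower set `Δ` is larger,
this says that `Δ` is a pure simplicial complex of dimension `d - 1`. -/
def IsPure (Δ : Set (Finset V)) (d : ℕ) : Prop := ∀ F ∈ Δ, ∃ D ∈ Δ, F ⊆ D ∧ #D = d

theorem IsPure.exists_superset_of_lk_singleton {d : ℕ} (h : IsPure (lk Δ {v}) d) (hF : F ∈ Δ)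
    (hv : v ∈ F) : ∃ D ∈ Δ, F ⊆ D ∧ #D = d + 1 := by
  obtain ⟨D, hD, hFD, hd⟩ := h _ (erase_mem_lk_singleton hv hF)
  obtain ⟨hvD, hD⟩ := mem_lk_singleton.mp hD
  exact ⟨_, hD, subset_insert_iff.mpr hFD, by rw [card_insert_of_notMem hvD, hd]⟩

/-- Zeroth cohomology detects connectedness: a property of vertices which spreads along edges is
a cocycle. -/
theorem AcyclicAt.forall_vertex [Nontrivial L] (h : AcyclicAt L Δ 1) {p : V → Prop}
    (hp : ∀ v w, {v, w} ∈ Δ → p v → p w) {v w : V} (hv : {v} ∈ Δ) (hw : {w} ∈ Δ) (hpv : p v) :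
    p w := by
  classical
  let c : Finset V → L := fun F => if ∀ u ∈ F, p u then 1 else 0
  have c_singleton (u : V) : c {u} = if p u then 1 else 0 := by simp [c]
  obtain ⟨b, hb⟩ := h c fun F hF hcard => by
    obtain ⟨x, y, hxy, rfl⟩ := card_eq_two.mp hcard
    have : p x ↔ p y := ⟨hp x y hF, hp y x (by rwa [pair_comm])⟩
    rw [koszulD_one_pair c hxy, c_singleton, c_singleton, if_congr this rfl rfl, sub_self, mul_zero]
  have c_eq (u : V) (hu : {u} ∈ Δ) : c {u} = b ∅ := by
    rw [← hb {u} hu (card_singleton u), koszulD_one_singleton]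
  by_contra hpw
  have : c {v} = c {w} := (c_eq v hv).trans (c_eq w hw).symm
  rw [c_singleton, c_singleton, if_pos hpv, if_neg hpw] at this
  exact one_ne_zero this

theorem LinksAcyclic.isPure [Nontrivial L] (d : ℕ) : ∀ {Δ : Set (Finset V)}, IsLowerSet Δ →
    LinksAcyclic L Δ → (∀ F ∈ Δ, #F ≤ d) → (∃ D ∈ Δ, #D = d) → IsPure Δ d := by
  induction d with
  | zero => exact fun _ _ hle _ G hG => ⟨G, hG, subset_rfl, Nat.le_zero.mp (hle G hG)⟩
  | succ d ih =>
    rintro Δ hΔ hL hle ⟨D, hD, hDcard⟩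
    let p (v : V) : Prop := ∃ E ∈ Δ, v ∈ E ∧ #E = d + 1
    have pure_lk (v : V) : p v → IsPure (lk Δ {v}) d := by
      rintro ⟨E, hE, hvE, hEcard⟩
      refine ih (isLowerSet_lk hΔ {v}) (hL.lk_singleton v) (fun F hF => ?_)
        ⟨E.erase v, erase_mem_lk_singleton hvE hE, by rw [card_erase_of_mem hvE, hEcard]; rfl⟩
      obtain ⟨hv, hF⟩ := mem_lk_singleton.mp hF
      simpa [card_insert_of_notMem hv] using hle _ hF
    have spread (v w : V) (hvw : {v, w} ∈ Δ) (hv : p v) : p w := by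
      obtain ⟨E, hE, hsub, hEcard⟩ :=
        (pure_lk v hv).exists_superset_of_lk_singleton hvw (mem_insert_self v _)
      exact ⟨E, hE, hsub (by simp), hEcard⟩
    have all_vertices (w : V) (hw : {w} ∈ Δ) : p w := by
      rcases Nat.eq_zero_or_pos d with rfl | hd
      · exact ⟨{w}, hw, mem_singleton_self w, card_singleton w⟩
      have connected : AcyclicAt L Δ 1 := by
        simpa using hL ∅ (hΔ (empty_subset D) hD) D (by rwa [lk_empty]) 1 (by omega)
      obtain ⟨u, hu⟩ := card_pos.mp (by omega : 0 < #D)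
      exact connected.forall_vertex spread (hΔ (singleton_subset_iff.mpr hu) hD) hw
        ⟨D, hD, hu, hDcard⟩
    intro F hF
    rcases F.eq_empty_or_nonempty with rfl | ⟨w, hw⟩
    · exact ⟨D, hD, empty_subset _, hDcard⟩
    · exact (pure_lk w (all_vertices w (hΔ (singleton_subset_iff.mpr hw) hF)))
        |>.exists_superset_of_lk_singleton hF hw

theorem LinksAcyclic.acyclicAt_lk [Nontrivial L] (hΔ : IsLowerSet Δ) (h : LinksAcyclic L Δ)
    {d : ℕ} (hle : ∀ F ∈ Δ, #F ≤ d) (hD : ∃ D ∈ Δ, #D = d) (G : Finset V) (n : ℕ)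
    (hn : n + #G < d) : AcyclicAt L (lk Δ G) n := by
  by_cases hG : G ∈ Δ
  · obtain ⟨D, hD, hGD, hc⟩ := h.isPure d hΔ hle hD G hG
    refine h G hG (D \ G) ⟨disjoint_sdiff, ?_⟩ n ?_
    · rwa [union_sdiff_of_subset hGD]
    · rw [card_sdiff_of_subset hGD]
      omega
  · rw [lk_eq_empty hΔ hG]
    exact acyclicAt_empty L n

theorem koszulD_one_baseChange {k : Type*} [CommRing k] [Algebra k L] (c : Finset V → L)
    (F : Finset V) : koszulD (1 : V → L) c F = koszulD (1 : V → k) c F := by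
  simp only [koszulD_apply, Pi.one_apply, mul_one]
  refine sum_congr rfl fun v _ => ?_
  rw [← map_koszulSign (algebraMap k L), algebraMap_smul]

theorem AcyclicAt.baseChange {k : Type*} [CommRing k] [Algebra k L] [Module.Free k L] [Finite V]
    (h : AcyclicAt k Δ n) : AcyclicAt L Δ n := by
  classical
  cases nonempty_fintype V
  intro c hc
  let B := Module.Free.chooseBasis k L
  have repr_koszulD (l : Finset V → L) (F : Finset V) (i) :
      B.repr (koszulD (1 : V → L) l F) i = koszulD (1 : V → k) (fun G => B.repr (l G) i) F := by
    rw [koszulD_one_baseChange (k := k)]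
    exact (koszulD_map (B.coord i) 1 l F).symm
  let T := univ.biUnion fun F : Finset V => (B.repr (c F)).support
  have exists_coord (i) : ∃ b : Finset V → k, (i ∉ T → b = 0) ∧
      ∀ F ∈ Δ, #F = n → koszulD (1 : V → k) b F = B.repr (c F) i := by
    by_cases hi : i ∈ T
    · obtain ⟨b, hb⟩ := h (fun F => B.repr (c F) i) fun F hF hn => by
        rw [← repr_koszulD, hc F hF hn, map_zero, Finsupp.zero_apply]
      exact ⟨b, absurd hi, hb⟩
    · have hi' : ∀ F, B.repr (c F) i = 0 := by simpa [T] using hi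
      exact ⟨0, fun _ => rfl, fun F _ _ => by rw [map_zero, hi', Pi.zero_apply]⟩
  choose b hbT hb using exists_coord
  refine ⟨fun F => B.repr.symm (Finsupp.onFinset T (fun i => b i F) fun i hi => ?_),
    fun F hF hn => B.repr.injective (Finsupp.ext fun i => ?_)⟩
  · by_contra hiT
    exact hi (congrFun (hbT i hiT) F)
  · rw [repr_koszulD, ← hb i F hF hn]
    simp

end Acyclic

/-! ### Reduced homology and simplicial cochains -/

section Homology

open CategoryTheory.Limits (IsZero)

variable {V : Type u}

theorem isLowerSet_faceSet (K : PreAbstractSimplicialComplex V) : IsLowerSet (faceSet K) :=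
  fun _ _ hle hs => mem_faceSet_of_subset K hs hle

theorem faceSet_link [DecidableEq V] (K : PreAbstractSimplicialComplex V) {σ : Finset V}
    (hσ : σ ∈ faceSet K) : faceSet (link K σ) = lk (faceSet K) σ := by
  ext τ
  constructor
  · rintro (rfl | h)
    · exact ⟨disjoint_empty_right σ, by rwa [union_empty]⟩
    · exact h.2
  · intro h
    rcases τ.eq_empty_or_nonempty with rfl | hτ
    · exact Or.inl rfl
    · exact Or.inr ⟨hτ, h⟩

theorem link_empty [DecidableEq V] (K : PreAbstractSimplicialComplex V) : link K ∅ = K := by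
  refine PreAbstractSimplicialComplex.ext (Set.ext fun τ => ⟨fun h => ?_, fun h => ?_⟩)
  · have : τ ∈ faceSet K := empty_union τ ▸ h.2.2
    exact this.resolve_left h.1.ne_empty
  · refine ⟨(K.isRelLowerSet_faces h).1, disjoint_empty_left τ, ?_⟩
    rw [empty_union]
    exact Or.inr h

theorem lt_dim_iff [Fintype V] (K : PreAbstractSimplicialComplex V) (n : ℕ) :
    (n : ℤ) - 1 < dim K ↔ ∃ F ∈ faceSet K, n < #F := by
  classical
  rw [dim, sub_lt_sub_iff_right, Nat.cast_lt, Finset.lt_sup_iff]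
  simp

variable (K : PreAbstractSimplicialComplex V)

section CommRing

variable {k : Type v} [CommRing k]

/-- The linear form on the `i`-chains of a complex given by a function on all finite sets. -/
noncomputable def cochain (i : ℤ) (c : Finset V → k) : Module.Dual k (Chains k K i) :=
  Finsupp.linearCombination k fun s => c s.1

theorem cochain_single (i : ℤ) (c : Finset V → k) (s) :
    cochain K i c (Finsupp.single s 1) = c s.1 := by
  simp [cochain]

theorem cochain_basisChain {i : ℤ} (c : Finset V → k) {t : Finset V} (ht : t ∈ faceSet K)
    (hc : (#t : ℤ) = i + 1) : cochain K i c (basisChain k K i t) = c t := by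
  rw [basisChain, dif_pos ⟨ht, hc⟩, cochain_single]

theorem cochain_apply_basisChain (i : ℤ) (φ : Module.Dual k (Chains k K i)) :
    cochain K i (fun t => φ (basisChain k K i t)) = φ := by
  refine Finsupp.lhom_ext' fun s => LinearMap.ext_ring ?_
  have : basisChain k K i s.1 = Finsupp.single s 1 := dif_pos s.2
  change cochain K i (fun t => φ (basisChain k K i t)) (Finsupp.single s 1) =
    φ (Finsupp.single s 1)
  rw [cochain_single, this]

variable [LinearOrder V]

theorem isZero_reducedHomology_iff_range_eq_ker (i : ℤ) :
    IsZero (reducedHomology k K i) ↔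
      LinearMap.range (boundary k K (i + 1) i) = LinearMap.ker (boundary k K i (i - 1)) := by
  rw [reducedHomology, ← HomologicalComplex.exactAt_iff_isZero_homology,
    HomologicalComplex.exactAt_iff' _ (i + 1) i (i - 1) (ChainComplex.prev ℤ i)
      (ChainComplex.next ℤ i), CategoryTheory.ShortComplex.moduleCat_exact_iff_range_eq_ker]
  rfl

theorem isZero_reducedHomology_of_lt {i : ℤ} (hi : i < -1) :
    IsZero (reducedHomology k K i) := by
  rw [isZero_reducedHomology_iff_range_eq_ker]
  have : IsEmpty {s : Finset V // s ∈ faceSet K ∧ (#s : ℤ) = i + 1} :=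
    ⟨fun s => by have := s.2.2; omega⟩
  exact Subsingleton.elim _ _

theorem dual_boundary_single (i j : ℤ) (φ : Module.Dual k (Chains k K j)) (s) :
    φ (boundary k K i j (Finsupp.single s 1)) =
      koszulD (1 : V → k) (fun t => φ (basisChain k K j t)) s.1 := by
  simp [boundary, koszulD_apply, koszulSign]

theorem cochain_boundary_single {i j : ℤ} (hij : j + 1 = i) (c : Finset V → k) (s) :
    cochain K j c (boundary k K i j (Finsupp.single s 1)) = koszulD (1 : V → k) c s.1 := by
  rw [dual_boundary_single]
  refine koszulD_congr _ fun v hv => cochain_basisChain K c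
    (mem_faceSet_of_subset K s.2.1 (erase_subset _ _)) ?_
  have := card_erase_add_one hv
  have := s.2.2
  omega

theorem cochain_mem_ker_dualMap_iff {i j : ℤ} (hij : j + 1 = i) (c : Finset V → k) :
    cochain K j c ∈ LinearMap.ker (boundary k K i j).dualMap ↔
      ∀ F ∈ faceSet K, (#F : ℤ) = i + 1 → koszulD (1 : V → k) c F = 0 := by
  rw [LinearMap.mem_ker]
  constructor
  · intro h F hF hi
    rw [← cochain_boundary_single K hij c ⟨F, hF, hi⟩]
    exact LinearMap.congr_fun h _
  · refine fun h => Finsupp.lhom_ext' fun s => LinearMap.ext_ring ?_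
    exact (cochain_boundary_single K hij c s).trans (h s.1 s.2.1 s.2.2)

theorem cochain_mem_range_dualMap_iff {i j : ℤ} (hij : j + 1 = i) (c : Finset V → k) :
    cochain K i c ∈ LinearMap.range (boundary k K i j).dualMap ↔
      ∃ b : Finset V → k, ∀ F ∈ faceSet K, (#F : ℤ) = i + 1 → koszulD (1 : V → k) b F = c F := by
  constructor
  · rintro ⟨φ, hφ⟩
    refine ⟨fun t => φ (basisChain k K j t), fun F hF hi => ?_⟩
    rw [← dual_boundary_single K i j φ ⟨F, hF, hi⟩, ← cochain_single K i c ⟨F, hF, hi⟩, ← hφ]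
    rfl
  · rintro ⟨b, hb⟩
    refine ⟨cochain K j b, Finsupp.lhom_ext' fun s => LinearMap.ext_ring ?_⟩
    exact (cochain_boundary_single K hij b s).trans
      ((hb s.1 s.2.1 s.2.2).trans (cochain_single K i c s).symm)

end CommRing

variable [LinearOrder V] {k : Type v} [Field k]

theorem range_eq_ker_iff_range_dualMap_eq_ker_dualMap {A B C : Type*} [AddCommGroup A] [Module k A]
    [AddCommGroup B] [Module k B] [AddCommGroup C] [Module k C] (f : A →ₗ[k] B) (g : B →ₗ[k] C) :
    LinearMap.range f = LinearMap.ker g ↔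
      LinearMap.range g.dualMap = LinearMap.ker f.dualMap := by
  rw [LinearMap.range_dualMap_eq_dualAnnihilator_ker,
    LinearMap.ker_dualMap_eq_dualAnnihilator_range, Subspace.dualAnnihilator_inj, eq_comm]

theorem isZero_reducedHomology_iff_acyclicAt (n : ℕ) :
    IsZero (reducedHomology k K (n - 1)) ↔ AcyclicAt k (faceSet K) n := by
  set f := boundary k K ((n : ℤ) - 1 + 1) (n - 1)
  set g := boundary k K ((n : ℤ) - 1) (n - 1 - 1)
  have range_le : LinearMap.range g.dualMap ≤ LinearMap.ker f.dualMap := by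
    rw [LinearMap.range_le_ker_iff, LinearMap.dualMap_comp_dualMap, boundary_comp k K _ _ _ rfl]
    exact map_zero Module.Dual.transpose
  rw [isZero_reducedHomology_iff_range_eq_ker, range_eq_ker_iff_range_dualMap_eq_ker_dualMap,
    ← range_le.ge_iff_eq]
  have hker (c : Finset V → k) : cochain K (n - 1) c ∈ LinearMap.ker f.dualMap ↔
      ∀ F ∈ faceSet K, #F = n + 1 → koszulD (1 : V → k) c F = 0 := by
    rw [cochain_mem_ker_dualMap_iff K rfl c]
    refine forall₂_congr fun F _ => imp_congr_left ?_
    omega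
  have hrange (c : Finset V → k) : cochain K (n - 1) c ∈ LinearMap.range g.dualMap ↔
      ∃ b : Finset V → k, ∀ F ∈ faceSet K, #F = n → koszulD (1 : V → k) b F = c F := by
    rw [cochain_mem_range_dualMap_iff K (sub_add_cancel _ 1) c]
    simp
  refine ⟨fun h c hc => (hrange c).mp (h ((hker c).mpr hc)), fun h φ hφ => ?_⟩
  rw [← cochain_apply_basisChain K _ φ] at hφ ⊢
  exact (hrange _).mpr (h _ ((hker _).mp hφ))

theorem forall_isZero_reducedHomology_iff [Fintype V] :
    (∀ i : ℤ, i < dim K → IsZero (reducedHomology k K i)) ↔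
      ∀ F ∈ faceSet K, ∀ n < #F, AcyclicAt k (faceSet K) n := by
  constructor
  · intro h F hF n hn
    exact (isZero_reducedHomology_iff_acyclicAt K n).mp (h _ ((lt_dim_iff K n).mpr ⟨F, hF, hn⟩))
  · intro h i hi
    rcases lt_or_ge i (-1) with hi' | hi'
    · exact isZero_reducedHomology_of_lt K hi'
    · obtain ⟨n, hn⟩ := Int.eq_ofNat_of_zero_le (by omega : 0 ≤ i + 1)
      obtain rfl : i = (n : ℤ) - 1 := by omega
      obtain ⟨F, hF, hn⟩ := (lt_dim_iff K n).mp hi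
      exact (isZero_reducedHomology_iff_acyclicAt K n).mpr (h F hF n hn)

theorem forall_isZero_reducedHomology_link_iff [Fintype V] :
    (∀ σ ∈ faceSet K, ∀ i : ℤ, i < dim (link K σ) → IsZero (reducedHomology k (link K σ) i)) ↔
      LinksAcyclic k (faceSet K) := by
  refine forall₂_congr fun σ hσ => ?_
  rw [forall_isZero_reducedHomology_iff, faceSet_link K hσ]

end Homology

/-! ### Stanley–Reisner ideals -/

section FaceIdeal

variable {V : Type*} (L : Type*) [CommRing L]

/-- The Stanley–Reisner ideal of a family `Δ` of finite sets: the ideal generated by the squarefree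
monomials whose support is not in `Δ`. It is `nonfaceIdeal` for the faces of a complex; families of
sets are used since deletions and links with respect to nonfaces may be empty. -/
noncomputable def faceIdeal (Δ : Set (Finset V)) : Ideal (MvPolynomial V L) :=
  Ideal.span {p | ∃ s : Finset V, s ∉ Δ ∧ p = ∏ i ∈ s, MvPolynomial.X i}

/-- The exponent of the squarefree monomial with support `F`. -/
noncomputable def ind (F : Finset V) : V →₀ ℕ := ∑ i ∈ F, Finsupp.single i 1

theorem ind_apply [DecidableEq V] (F : Finset V) (v : V) : ind F v = if v ∈ F then 1 else 0 := by
  simp [ind, Finsupp.finsetSum_apply, Finsupp.single_apply]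

theorem ind_le_iff {F : Finset V} {m : V →₀ ℕ} : ind F ≤ m ↔ F ⊆ m.support := by
  classical
  refine forall_congr' fun v => ?_
  rw [ind_apply, Finsupp.mem_support_iff]
  split_ifs with hv <;> simp [hv, Nat.one_le_iff_ne_zero]

variable {L}

theorem prod_X_eq_monomial_ind (F : Finset V) :
    ∏ i ∈ F, (MvPolynomial.X i : MvPolynomial V L) = MvPolynomial.monomial (ind F) 1 := by
  simp [ind, MvPolynomial.monomial_sum_one, MvPolynomial.X]

theorem mem_faceIdeal_iff {Δ : Set (Finset V)} (hΔ : IsLowerSet Δ) {p : MvPolynomial V L} :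
    p ∈ faceIdeal L Δ ↔ ∀ m : V →₀ ℕ, m.support ∈ Δ → p.coeff m = 0 := by
  have generators : {p : MvPolynomial V L | ∃ s : Finset V, s ∉ Δ ∧ p = ∏ i ∈ s, .X i} =
      (fun m => MvPolynomial.monomial m 1) '' (ind '' Δᶜ) := by
    ext p
    simp [prod_X_eq_monomial_ind, eq_comm]
  rw [faceIdeal, generators, MvPolynomial.mem_ideal_span_monomial_image]
  refine forall_congr' fun m => ?_
  have : (∃ e ∈ ind '' Δᶜ, e ≤ m) ↔ m.support ∉ Δ := by
    simp only [Set.exists_mem_image, ind_le_iff]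
    exact ⟨fun ⟨s, hs, hsm⟩ hm => hs (hΔ hsm hm), fun hm => ⟨_, hm, subset_rfl⟩⟩
  rw [MvPolynomial.mem_support_iff, this, not_imp_not]

end FaceIdeal

/-! ### Cochains on the sets containing a given set -/

section Twist

variable {V : Type*} [LinearOrder V] {L : Type*} [CommRing L]

theorem koszulSign_union (v : V) {F G : Finset V} (h : Disjoint F G) :
    koszulSign L v (F ∪ G) = koszulSign L v F * koszulSign L v G := by
  rw [koszulSign, filter_union, card_union_of_disjoint (disjoint_filter_filter h), pow_add,
    koszulSign, koszulSign]

variable (L) in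
/-- The sign by which the differentials of `F` and `F ∪ G` differ. -/
def twist (G F : Finset V) : L := ∏ v ∈ F, koszulSign L v G

@[simp]
theorem twist_mul_self (G F : Finset V) : twist L G F * twist L G F = 1 := by
  simp [twist, ← prod_mul_distrib]

theorem twist_eq_mul_twist_erase (G : Finset V) {F : Finset V} {v : V} (hv : v ∈ F) :
    twist L G F = koszulSign L v G * twist L G (F.erase v) :=
  (mul_prod_erase F _ hv).symm

/-- Restriction of a cochain to the sets containing `G`, indexed by the complement of `G`. -/
def shiftDown (G : Finset V) (c : Finset V → L) (F : Finset V) : L := twist L G F * c (F ∪ G)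

/-- Extension by zero of a cochain, from the sets avoiding `G` to the sets containing `G`. -/
def shiftUp (G : Finset V) (b : Finset V → L) (F : Finset V) : L :=
  if G ⊆ F then twist L G (F \ G) * b (F \ G) else 0

theorem shiftUp_of_not_subset {G F : Finset V} (h : ¬ G ⊆ F) (b : Finset V → L) :
    shiftUp G b F = 0 := if_neg h

theorem shiftUp_union {G F : Finset V} (h : Disjoint F G) (b : Finset V → L) :
    shiftUp G b (F ∪ G) = twist L G F * b F := by
  rw [shiftUp, if_pos subset_union_right, union_sdiff_cancel_right h]

theorem shiftDown_shiftUp {G F : Finset V} (h : Disjoint F G) (b : Finset V → L) :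
    shiftDown G (shiftUp G b) F = b F := by
  rw [shiftDown, shiftUp_union h, ← mul_assoc, twist_mul_self, one_mul]

theorem koszulD_shiftDown {G : Finset V} {c : Finset V → L} (hc : ∀ F, ¬ G ⊆ F → c F = 0)
    {F : Finset V} (h : Disjoint F G) :
    koszulD (1 : V → L) (shiftDown G c) F =
      twist L G F * koszulD (1 : V → L) c (F ∪ G) := by
  have term_of_mem_right : ∀ v ∈ G,
      (koszulSign L v (F ∪ G) * (1 : V → L) v) • c ((F ∪ G).erase v) = 0 := fun v hv => by
    rw [hc _ fun h' => notMem_erase v _ (h' hv), smul_zero]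
  rw [koszulD_apply, koszulD_apply, sum_union h, sum_eq_zero term_of_mem_right, add_zero, mul_sum]
  refine sum_congr rfl fun v hv => ?_
  have herase : (F ∪ G).erase v = F.erase v ∪ G := by
    rw [erase_union_distrib, erase_eq_of_notMem (disjoint_left.mp h hv)]
  rw [herase, shiftDown, twist_eq_mul_twist_erase G hv, koszulSign_union v h]
  simp only [Pi.one_apply, mul_one, smul_eq_mul]
  linear_combination (-koszulSign L v F * twist L G (F.erase v) * c (F.erase v ∪ G)) *
    koszulSign_mul_self (R := L) v G

theorem koszulD_shiftUp {G : Finset V} (b : Finset V → L) {F : Finset V} (h : Disjoint F G) :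
    koszulD (1 : V → L) (shiftUp G b) (F ∪ G) = twist L G F * koszulD (1 : V → L) b F := by
  have down_up : koszulD (1 : V → L) (shiftDown G (shiftUp G b)) F = koszulD (1 : V → L) b F :=
    koszulD_congr _ fun v _ => shiftDown_shiftUp (h.mono_left (erase_subset v F)) b
  rw [← down_up, koszulD_shiftDown (fun _ h' => shiftUp_of_not_subset h' b) h, ← mul_assoc,
    twist_mul_self, one_mul]

end Twist

/-! ### Koszul cohomology of a face ring -/

section KoszulVanishes

variable {V : Type*} [LinearOrder V] {R : Type*} [CommRing R] {N : Type*} [AddCommGroup N]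
  [Module R N]

/-- Vanishing in degree `i` of the Koszul cohomology of the family `x` with coefficients in `N ⧸ P`
after localization at `S`; for `S = ⊥` there is no localization. The cochains have values in `N`
itself, so that no quotient and no localization has to be formed. -/
def KoszulVanishes (S : Submonoid R) (x : V → R) (P : Submodule R N) (i : ℕ) : Prop :=
  ∀ c : Finset V → N, (∀ F, #F = i + 1 → koszulD x c F ∈ P) →
    ∃ s ∈ S, ∃ b : Finset V → N, ∀ F, #F = i → s • c F - koszulD x b F ∈ P

theorem koszulVanishes_bot_iff {x : V → R} {P : Submodule R N} {i : ℕ} :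
    KoszulVanishes ⊥ x P i ↔ ∀ c : Finset V → N, (∀ F, #F = i + 1 → koszulD x c F ∈ P) →
      ∃ b : Finset V → N, ∀ F, #F = i → c F - koszulD x b F ∈ P := by
  simp [KoszulVanishes]

theorem KoszulVanishes.mono {S T : Submonoid R} (hST : S ≤ T) {x : V → R} {P : Submodule R N}
    {i : ℕ} (h : KoszulVanishes S x P i) : KoszulVanishes T x P i := fun c hc =>
  (h c hc).imp fun _ hs => hs.imp_left (hST ·)

end KoszulVanishes

section Hochster

open MvPolynomial (monomial coeff X)

variable {V : Type*} {L : Type*} [CommRing L]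

@[simp]
theorem support_ind (F : Finset V) : (ind F).support = F := by
  ext v
  classical
  rw [Finsupp.mem_support_iff, ind_apply, ite_ne_right_iff, and_iff_left one_ne_zero]

theorem add_ind_sub_ind (m : V →₀ ℕ) (F : Finset V) : m + ind F - ind F = m :=
  add_tsub_cancel_right m _

theorem subset_support_add_ind (m : V →₀ ℕ) (F : Finset V) : F ⊆ (m + ind F).support :=
  ind_le_iff.mp le_add_self

theorem sub_ind_add_ind {a : V →₀ ℕ} {F : Finset V} (h : F ⊆ a.support) :
    a - ind F + ind F = a := tsub_add_cancel_of_le (ind_le_iff.mpr h)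

variable [LinearOrder V]

section Multidegrees

variable [Fintype V]

/-- The component of multidegree `a - (1, …, 1)` of a Koszul cochain of the polynomial ring; the
basis vector of index `F` has multidegree `- ind F`. -/
noncomputable def component (a : V →₀ ℕ) :
    (Finset V → MvPolynomial V L) →ₗ[L] (Finset V → L) where
  toFun c F := if Fᶜ ⊆ a.support then (c F).coeff (a - ind Fᶜ) else 0
  map_add' c c' := by
    ext F
    by_cases h : Fᶜ ⊆ a.support <;> simp [h]
  map_smul' r c := by
    ext F
    by_cases h : Fᶜ ⊆ a.support <;> simp [h]

theorem component_of_subset {a : V →₀ ℕ} {F : Finset V} (h : Fᶜ ⊆ a.support)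
    (c : Finset V → MvPolynomial V L) : component a c F = (c F).coeff (a - ind Fᶜ) := if_pos h

theorem component_of_not_subset {a : V →₀ ℕ} {F : Finset V} (h : ¬ Fᶜ ⊆ a.support)
    (c : Finset V → MvPolynomial V L) : component a c F = 0 := if_neg h

theorem coeff_X_mul_eq_component {a : V →₀ ℕ} {F : Finset V} {v : V} (h : Fᶜ ⊆ a.support)
    (hv : v ∈ F) (c : Finset V → MvPolynomial V L) :
    (X v * c (F.erase v)).coeff (a - ind Fᶜ) = component a c (F.erase v) := by
  have hvF : v ∉ Fᶜ := by simpa using hv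
  have ind_insert : ind (F.erase v)ᶜ = ind Fᶜ + Finsupp.single v 1 := by
    rw [compl_erase, ind, sum_insert hvF, add_comm, ind]
  have mem_support : v ∈ (a - ind Fᶜ).support ↔ (F.erase v)ᶜ ⊆ a.support := by
    simp [ind_apply, hv, compl_erase, insert_subset_iff, h]
  rw [MvPolynomial.coeff_X_mul', if_congr mem_support rfl rfl, tsub_tsub, ← ind_insert]
  rfl

theorem component_koszulD (a : V →₀ ℕ) (c : Finset V → MvPolynomial V L) (F : Finset V) :
    component a (koszulD (R := MvPolynomial V L) X c) F =
      koszulD (1 : V → L) (component a c) F := by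
  by_cases h : Fᶜ ⊆ a.support
  · rw [component_of_subset h, koszulD_apply, koszulD_apply, MvPolynomial.coeff_sum]
    refine sum_congr rfl fun v hv => ?_
    rw [← map_koszulSign MvPolynomial.C, smul_eq_mul, mul_assoc, MvPolynomial.coeff_C_mul,
      coeff_X_mul_eq_component h hv, Pi.one_apply, mul_one, smul_eq_mul]
  · rw [component_of_not_subset h, koszulD_apply, sum_eq_zero fun v _ => ?_]
    rw [component_of_not_subset (mt (subset_trans (compl_subset_compl.mpr (erase_subset v F))) h),
      smul_zero]

theorem finite_component_ne_zero (c : Finset V → MvPolynomial V L) :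
    {a : V →₀ ℕ | component a c ≠ 0}.Finite := by
  refine (Set.finite_iUnion fun F => (c F).support.finite_toSet.image (· + ind Fᶜ)).subset ?_
  intro a ha
  obtain ⟨F, hF⟩ := Function.ne_iff.mp ha
  have hFa : Fᶜ ⊆ a.support := not_not.mp fun h => hF (component_of_not_subset h c)
  rw [component_of_subset hFa] at hF
  exact Set.mem_iUnion.mpr ⟨F, a - ind Fᶜ, MvPolynomial.mem_support_iff.mpr hF,
    sub_ind_add_ind hFa⟩

/-- The Koszul cochain of the polynomial ring whose only component is `b`, in multidegree
`a - (1, …, 1)`. -/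
noncomputable def ofComponent (a : V →₀ ℕ) (b : Finset V → L) (F : Finset V) : MvPolynomial V L :=
  monomial (a - ind Fᶜ) (b F)

theorem component_ofComponent {a : V →₀ ℕ} {b : Finset V → L}
    (hb : ∀ F, ¬ Fᶜ ⊆ a.support → b F = 0) (a' : V →₀ ℕ) :
    component a' (ofComponent a b) = if a' = a then b else 0 := by
  ext F
  by_cases hF : Fᶜ ⊆ a'.support
  · rw [component_of_subset hF, ofComponent, MvPolynomial.coeff_monomial]
    by_cases hFa : Fᶜ ⊆ a.support
    · have : a - ind Fᶜ = a' - ind Fᶜ ↔ a' = a :=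
        ⟨fun e => by rw [← sub_ind_add_ind hF, ← e, sub_ind_add_ind hFa], fun e => e ▸ rfl⟩
      split_ifs <;> simp_all
    · have : a' ≠ a := fun e => hFa (e ▸ hF)
      simp [hb F hFa, this]
  · rw [component_of_not_subset hF]
    split_ifs with e
    · exact (hb F (e ▸ hF)).symm
    · rfl

variable {Δ : Set (Finset V)}

/-- The sets `F` for which the component in multidegree `a - (1, …, 1)` of a cochain matters at `F`
modulo the face ideal of `Δ`. -/
def visible (Δ : Set (Finset V)) (a : V →₀ ℕ) : Set (Finset V) :=
  {F | Fᶜ ⊆ a.support ∧ (a - ind Fᶜ).support ∈ Δ}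

theorem mem_faceIdeal_iff_component (hΔ : IsLowerSet Δ) (c : Finset V → MvPolynomial V L)
    (F : Finset V) : c F ∈ faceIdeal L Δ ↔ ∀ a, F ∈ visible Δ a → component a c F = 0 := by
  rw [mem_faceIdeal_iff hΔ]
  constructor
  · rintro h a ⟨ha, hm⟩
    rw [component_of_subset ha]
    exact h _ hm
  · intro h m hm
    have hsub := subset_support_add_ind m Fᶜ
    have := h (m + ind Fᶜ) ⟨hsub, by rwa [add_ind_sub_ind]⟩
    rwa [component_of_subset hsub, add_ind_sub_ind] at this

/-- Vanishing in degree `i` of the component of multidegree `a - (1, …, 1)` of the Koszul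
cohomology of the variables on the face ring of `Δ`. -/
def ComponentVanishes (L : Type*) [CommRing L] (Δ : Set (Finset V)) (a : V →₀ ℕ) (i : ℕ) : Prop :=
  ∀ c : Finset V → L, (∀ F, ¬ Fᶜ ⊆ a.support → c F = 0) →
    (∀ F ∈ visible Δ a, #F = i + 1 → koszulD (1 : V → L) c F = 0) →
      ∃ b : Finset V → L, (∀ F, ¬ Fᶜ ⊆ a.support → b F = 0) ∧
        ∀ F ∈ visible Δ a, #F = i → koszulD (1 : V → L) b F = c F

theorem componentVanishes_of_koszulVanishes (hΔ : IsLowerSet Δ) {i : ℕ}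
    (h : KoszulVanishes ⊥ (R := MvPolynomial V L) X (faceIdeal L Δ) i) (a : V →₀ ℕ) :
    ComponentVanishes L Δ a i := by
  intro c hca hc
  obtain ⟨b, hb⟩ := koszulVanishes_bot_iff.mp h (ofComponent a c) fun F hF => by
    rw [mem_faceIdeal_iff_component hΔ]
    intro a' ha'
    rw [component_koszulD, component_ofComponent hca]
    split_ifs with e
    · exact hc F (e ▸ ha') hF
    · simp
  refine ⟨component a b, fun F hF => component_of_not_subset hF b, fun F hFa hF => ?_⟩
  have := (mem_faceIdeal_iff_component hΔ (ofComponent a c - koszulD X b) F).mp (hb F hF) a hFa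
  rw [map_sub, Pi.sub_apply, component_koszulD, component_ofComponent hca, if_pos rfl,
    sub_eq_zero] at this
  exact this.symm

theorem koszulVanishes_of_componentVanishes (hΔ : IsLowerSet Δ) {i : ℕ}
    (h : ∀ a : V →₀ ℕ, ComponentVanishes L Δ a i) :
    KoszulVanishes ⊥ (R := MvPolynomial V L) X (faceIdeal L Δ) i := by
  refine koszulVanishes_bot_iff.mpr fun c hc => ?_
  have exists_primitive (a : V →₀ ℕ) : ∃ b : Finset V → L, (component a c = 0 → b = 0) ∧
      (∀ F, ¬ Fᶜ ⊆ a.support → b F = 0) ∧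
      ∀ F ∈ visible Δ a, #F = i → koszulD (1 : V → L) b F = component a c F := by
    by_cases ha : component a c = 0
    · exact ⟨0, fun _ => rfl, fun _ _ => rfl, fun F _ _ => by simp [ha]⟩
    · obtain ⟨b, hba, hb⟩ := h a (component a c) (fun F hF => component_of_not_subset hF c)
        fun F hFa hF => by
          rw [← component_koszulD]
          exact (mem_faceIdeal_iff_component hΔ _ F).mp (hc F hF) a hFa
      exact ⟨b, fun h' => absurd h' ha, hba, hb⟩
  choose b hb0 hba hb using exists_primitive
  let T := (finite_component_ne_zero c).toFinset
  have component_sum (a : V →₀ ℕ) : component a (∑ a' ∈ T, ofComponent a' (b a')) = b a := by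
    simp only [map_sum, component_ofComponent (hba _), sum_ite_eq, ite_eq_left_iff]
    exact fun ha => (hb0 a (by simpa [T] using ha)).symm
  refine ⟨∑ a ∈ T, ofComponent a (b a), fun F hF => ?_⟩
  rw [← Pi.sub_apply, mem_faceIdeal_iff_component hΔ]
  intro a hFa
  rw [map_sub, Pi.sub_apply, component_koszulD, component_sum, hb a F hFa hF, sub_self]

theorem compl_insert_subset_support_iff {a : V →₀ ℕ} {p : V} (hp : p ∈ a.support)
    {F : Finset V} : (insert p F)ᶜ ⊆ a.support ↔ Fᶜ ⊆ a.support := by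
  rw [compl_insert, erase_subset_iff_of_mem hp]

theorem insert_mem_visible {a : V →₀ ℕ} {p : V} (hp : 2 ≤ a p) {F : Finset V} :
    insert p F ∈ visible Δ a ↔ F ∈ visible Δ a := by
  have hpa : p ∈ a.support := Finsupp.mem_support_iff.mpr (by omega)
  have : (a - ind (insert p F)ᶜ).support = (a - ind Fᶜ).support := by
    ext v
    by_cases hv : v = p
    · subst hv
      by_cases hF : v ∈ F <;> simp [ind_apply, hF]; omega
    · simp [ind_apply, hv]
  rw [visible, Set.mem_ofPred_eq, Set.mem_ofPred_eq, compl_insert_subset_support_iff hpa, this]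

/-- Contraction with `p` is a contracting homotopy since adjoining `p` to a set does not affect its
visibility. -/
theorem componentVanishes_of_two_le {a : V →₀ ℕ} {p : V} (hp : 2 ≤ a p) (i : ℕ) :
    ComponentVanishes L Δ a i := by
  intro c hca hc
  refine ⟨contract L p c, fun F hF => ?_, fun F hFa hF => ?_⟩
  · by_cases hpF : p ∈ F
    · exact contract_of_mem hpF c
    · have hpa : p ∈ a.support := Finsupp.mem_support_iff.mpr (by omega)
      rw [contract_of_notMem hpF, hca _ (mt (compl_insert_subset_support_iff hpa).mp hF), smul_zero]
  · have homotopy := contract_koszulD (1 : V → L) p c F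
    rw [Pi.one_apply, one_smul] at homotopy
    rw [← homotopy, right_eq_add]
    by_cases hpF : p ∈ F
    · exact contract_of_mem hpF _
    · rw [contract_of_notMem hpF, hc _ ((insert_mem_visible hp).mpr hFa), smul_zero]
      rw [card_insert_of_notMem hpF, hF]

theorem compl_subset_support_ind_compl {F G : Finset V} : Fᶜ ⊆ (ind Gᶜ).support ↔ G ⊆ F := by
  rw [support_ind, compl_subset_compl]

theorem union_mem_visible_ind_compl {F G : Finset V} (h : Disjoint F G) :
    F ∪ G ∈ visible Δ (ind Gᶜ) ↔ F ∈ Δ := by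
  have : (ind Gᶜ - ind (F ∪ G)ᶜ).support = F := by
    ext v
    have : v ∈ F → v ∉ G := fun hF => disjoint_left.mp h hF
    by_cases hF : v ∈ F <;> by_cases hG : v ∈ G <;> simp_all [ind_apply]
  rw [visible, Set.mem_ofPred_eq, compl_subset_support_ind_compl, this]
  exact and_iff_right subset_union_right

theorem componentVanishes_ind_compl_iff (G : Finset V) (n : ℕ) :
    ComponentVanishes L Δ (ind Gᶜ) (n + #G) ↔ AcyclicAt L (del Δ G) n := by
  have exists_eq_union {F : Finset V} (hF : F ∈ visible Δ (ind Gᶜ)) {m : ℕ} (hm : #F = m + #G) :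
      ∃ E ∈ del Δ G, F = E ∪ G ∧ #E = m := by
    obtain ⟨E, hE, rfl⟩ : ∃ E, Disjoint G E ∧ F = E ∪ G := ⟨F \ G, disjoint_sdiff,
      (sdiff_union_of_subset (compl_subset_support_ind_compl.mp hF.1)).symm⟩
    rw [card_union_of_disjoint hE.symm, Nat.add_right_cancel_iff] at hm
    exact ⟨E, ⟨hE, (union_mem_visible_ind_compl hE.symm).mp hF⟩, rfl, hm⟩
  simp only [ComponentVanishes, compl_subset_support_ind_compl]
  constructor
  · intro h c hc
    obtain ⟨b, hbG, hb⟩ := h (shiftUp G c) (fun F hF => shiftUp_of_not_subset hF c)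
      fun F hFa hF => by
        obtain ⟨E, hE, rfl, hEn⟩ := exists_eq_union hFa (hF.trans (add_right_comm _ _ _))
        rw [koszulD_shiftUp c hE.1.symm, hc E hE hEn, mul_zero]
    refine ⟨shiftDown G b, fun F hF hn => ?_⟩
    rw [koszulD_shiftDown hbG hF.1.symm, hb _ ((union_mem_visible_ind_compl hF.1.symm).mpr hF.2)
      (by rw [card_union_of_disjoint hF.1.symm, hn])]
    exact shiftDown_shiftUp hF.1.symm c
  · intro h c hcG hc
    obtain ⟨b, hb⟩ := h (shiftDown G c) fun F hF hn => by
      rw [koszulD_shiftDown hcG hF.1.symm,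
        hc _ ((union_mem_visible_ind_compl hF.1.symm).mpr hF.2), mul_zero]
      rw [card_union_of_disjoint hF.1.symm, hn, add_right_comm]
    refine ⟨shiftUp G b, fun F hF => shiftUp_of_not_subset hF b, fun F hFa hF => ?_⟩
    obtain ⟨E, hE, rfl, hEn⟩ := exists_eq_union hFa hF
    rw [koszulD_shiftUp b hE.1.symm, hb E hE hEn, shiftDown, ← mul_assoc, twist_mul_self, one_mul]

end Multidegrees

theorem koszulVanishes_faceIdeal_iff [Finite V] {Δ : Set (Finset V)} (hΔ : IsLowerSet Δ) (i : ℕ) :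
    KoszulVanishes ⊥ (R := MvPolynomial V L) X (faceIdeal L Δ) i ↔
      ∀ (G : Finset V) (n : ℕ), n + #G = i → AcyclicAt L (del Δ G) n := by
  cases nonempty_fintype V
  constructor
  · rintro h G n rfl
    exact (componentVanishes_ind_compl_iff G n).mp (componentVanishes_of_koszulVanishes hΔ h _)
  · refine fun h => koszulVanishes_of_componentVanishes hΔ fun a => ?_
    by_cases ha : ∃ p, 2 ≤ a p
    · exact componentVanishes_of_two_le ha.choose_spec i
    push Not at ha
    obtain ⟨G, rfl⟩ : ∃ G : Finset V, a = ind Gᶜ := ⟨a.supportᶜ, Finsupp.ext fun v => by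
      have := ha v
      simp only [compl_compl, ind_apply, Finsupp.mem_support_iff]
      split_ifs <;> omega⟩
    rcases lt_or_ge i #G with hi | hi
    · refine fun c _ _ => ⟨0, fun _ _ => rfl, fun F hFa hF => ?_⟩
      have := card_le_card (compl_subset_support_ind_compl.mp hFa.1)
      omega
    · obtain ⟨n, rfl⟩ := Nat.exists_eq_add_of_le' hi
      exact (componentVanishes_ind_compl_iff G n).mpr (h G n rfl)

end Hochster

section Depth

variable {V : Type*} [LinearOrder V] {R : Type*} [CommRing R] {x : V → R}

section Submodule

variable {N : Type*} [AddCommGroup N] [Module R N] {P : Submodule R N}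

theorem exists_smul_sub_koszulD_mem {c : Finset V → N} {i : ℕ}
    (hc : ∀ F, #F = i + 1 → koszulD x c F ∈ P) {r : R} (hr : r ∈ Ideal.span (Set.range x)) :
    ∃ b : Finset V → N, ∀ F, #F = i → r • c F - koszulD x b F ∈ P := by
  induction hr using Submodule.span_induction with
  | mem r hr =>
    obtain ⟨v, rfl⟩ := hr
    refine ⟨contract R v c, fun F hF => ?_⟩
    rw [← contract_koszulD, add_sub_cancel_right]
    by_cases hv : v ∈ F
    · rw [contract_of_mem hv]
      exact P.zero_mem
    · rw [contract_of_notMem hv]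
      exact P.smul_mem _ (hc _ (by rw [card_insert_of_notMem hv, hF]))
  | zero => exact ⟨0, fun F _ => by simp⟩
  | add r s _ _ hr hs =>
    obtain ⟨b, hb⟩ := hr
    obtain ⟨b', hb'⟩ := hs
    refine ⟨b + b', fun F hF => ?_⟩
    rw [add_smul, map_add, Pi.add_apply, add_sub_add_comm]
    exact P.add_mem (hb F hF) (hb' F hF)
  | smul a r _ hr =>
    obtain ⟨b, hb⟩ := hr
    refine ⟨a • b, fun F hF => ?_⟩
    rw [map_smul, Pi.smul_apply, smul_assoc, ← smul_sub]
    exact P.smul_mem a (hb F hF)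

theorem KoszulVanishes.of_isUnit_mod_span {S : Submonoid R} {i : ℕ} (h : KoszulVanishes S x P i)
    (hS : ∀ s ∈ S, ∃ t, 1 - t * s ∈ Ideal.span (Set.range x)) : KoszulVanishes ⊥ x P i := by
  refine koszulVanishes_bot_iff.mpr fun c hc => ?_
  obtain ⟨s, hs, b, hb⟩ := h c hc
  obtain ⟨t, ht⟩ := hS s hs
  obtain ⟨b', hb'⟩ := exists_smul_sub_koszulD_mem hc ht
  refine ⟨b' + t • b, fun F hF => ?_⟩
  have : c F - koszulD x (b' + t • b) F =
      ((1 - t * s) • c F - koszulD x b' F) + t • (s • c F - koszulD x b F) := by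
    rw [map_add, map_smul, Pi.add_apply, Pi.smul_apply]
    module
  rw [this]
  exact P.add_mem (hb' F hF) (P.smul_mem t (hb F hF))

theorem KoszulVanishes.of_quotient {S : Submonoid R} {i : ℕ}
    (h : KoszulVanishes S x (⊥ : Submodule R (N ⧸ P)) i) : KoszulVanishes S x P i := by
  intro c hc
  have mk_koszulD (c : Finset V → N) (F : Finset V) :
      koszulD x (fun F => P.mkQ (c F)) F = P.mkQ (koszulD x c F) := koszulD_map ..
  obtain ⟨s, hs, b, hb⟩ := h (fun F => P.mkQ (c F)) fun F hF => by
    rw [mk_koszulD]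
    exact (Submodule.Quotient.mk_eq_zero P).mpr (hc F hF)
  choose b' hb' using fun F => P.mkQ_surjective (b F)
  obtain rfl : (fun F => P.mkQ (b' F)) = b := funext hb'
  refine ⟨s, hs, b', fun F hF => (Submodule.Quotient.mk_eq_zero P).mp ?_⟩
  have := hb F hF
  rwa [mk_koszulD, ← map_smul, ← map_sub] at this

end Submodule

section Regular

variable {N : Type v} [AddCommGroup N] [Module R N]

theorem koszulVanishes_zero_of_isSMulRegular {r : R} (hr : IsSMulRegular N r)
    (hrx : r ∈ Ideal.span (Set.range x)) : KoszulVanishes ⊥ x (⊥ : Submodule R N) 0 := by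
  refine koszulVanishes_bot_iff.mpr fun c hc => ⟨0, fun F hF => ?_⟩
  obtain ⟨b, hb⟩ := exists_smul_sub_koszulD_mem hc hrx
  obtain rfl := card_eq_zero.mp hF
  have smul_eq_zero : r • c ∅ = 0 := by simpa [koszulD_apply] using hb ∅ rfl
  simpa using hr.right_eq_zero_of_smul smul_eq_zero

theorem KoszulVanishes.succ_of_isSMulRegular {r : R} {i : ℕ}
    (h : KoszulVanishes ⊥ x (⊥ : Submodule R (QuotSMulTop r N)) i) (hr : IsSMulRegular N r)
    (hrx : r ∈ Ideal.span (Set.range x)) : KoszulVanishes ⊥ x (⊥ : Submodule R N) (i + 1) := by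
  have h := koszulVanishes_bot_iff.mp h.of_quotient
  refine koszulVanishes_bot_iff.mpr fun c hc => ?_
  obtain ⟨b, hb⟩ := exists_smul_sub_koszulD_mem hc hrx
  simp only [Submodule.mem_bot, sub_eq_zero] at hb ⊢
  obtain ⟨l, hl⟩ := h b fun F hF => by
    rw [← hb F hF]
    exact Submodule.smul_mem_pointwise_smul _ _ _ trivial
  have exists_smul_eq (F : Finset V) : ∃ f : N, #F = i → b F - koszulD x l F = r • f := by
    by_cases hF : #F = i
    · obtain ⟨f, -, hf⟩ := (Submodule.mem_smul_pointwise_iff_exists _ _ _).mp (hl F hF)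
      exact ⟨f, fun _ => hf.symm⟩
    · exact ⟨0, fun h => absurd h hF⟩
  choose f hf using exists_smul_eq
  refine ⟨f, fun F hF => hr ?_⟩
  calc r • c F = koszulD x (b - koszulD x l) F := by
        rw [hb F hF, map_sub, Pi.sub_apply, koszulD_koszulD, sub_zero]
    _ = koszulD x (r • f) F :=
        koszulD_congr _ fun v hv => hf _ (by rw [card_erase_of_mem hv, hF, Nat.add_sub_cancel])
    _ = r • koszulD x f F := by rw [map_smul, Pi.smul_apply]

theorem koszulVanishes_of_isWeaklyRegular {rs : List R}
    (hrs : RingTheory.Sequence.IsWeaklyRegular N rs) (hx : ∀ r ∈ rs, r ∈ Ideal.span (Set.range x))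
    {i : ℕ} (hi : i < rs.length) : KoszulVanishes ⊥ x (⊥ : Submodule R N) i := by
  induction rs generalizing N i with
  | nil => exact absurd hi (Nat.not_lt_zero i)
  | cons r rs ih =>
    obtain ⟨hr, hrs⟩ := (RingTheory.Sequence.isWeaklyRegular_cons_iff N r rs).mp hrs
    have hrx := hx r List.mem_cons_self
    cases i with
    | zero => exact koszulVanishes_zero_of_isSMulRegular hr hrx
    | succ i =>
      exact (ih hrs (fun s hs => hx s (List.mem_cons_of_mem _ hs))
        (by simpa using hi)).succ_of_isSMulRegular hr hrx

end Regular

end Depth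

/-! ### Locally regular sequences -/

section LocRegular

variable {B : Type*} [CommRing B]

/-- Multiplication by `r` is injective on the localization of `B ⧸ I` at `S`. -/
def IsLocRegular (S : Submonoid B) (I : Ideal B) (r : B) : Prop :=
  ∀ g, r * g ∈ I → ∃ s ∈ S, s * g ∈ I

/-- The sequence `rs` is weakly regular on the localization of `B ⧸ I` at `S`. -/
def IsLocRegularSeq (S : Submonoid B) : Ideal B → List B → Prop
  | _, [] => True
  | I, r :: rs => IsLocRegular S I r ∧ IsLocRegularSeq S (I ⊔ Ideal.span {r}) rs

theorem exists_mem_forall_mul_mem (S : Submonoid B) {ι : Type*} [Finite ι] {I : Ideal B}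
    {g : ι → B} {p : ι → Prop} (h : ∀ i, p i → ∃ s ∈ S, s * g i ∈ I) :
    ∃ s ∈ S, ∀ i, p i → s * g i ∈ I := by
  classical
  cases nonempty_fintype ι
  have (i : ι) : ∃ s ∈ S, p i → s * g i ∈ I := by
    by_cases hi : p i
    · obtain ⟨s, hs, hg⟩ := h i hi
      exact ⟨s, hs, fun _ => hg⟩
    · exact ⟨1, S.one_mem, fun h => absurd h hi⟩
  choose s hs hg using this
  refine ⟨∏ i, s i, S.prod_mem fun i _ => hs i, fun i hi => ?_⟩
  rw [← mul_prod_erase _ _ (mem_univ i), mul_right_comm]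
  exact I.mul_mem_right _ (hg i hi)

/-- Prime avoidance for the associated primes of `N` that survive in the localization at `S`. -/
theorem exists_mem_forall_smul_eq_zero [IsNoetherianRing B] {N : Type*} [AddCommGroup N]
    [Module B N] [Module.Finite B N] (S : Submonoid B) (J : Ideal B)
    (h : ∀ g : N, (∀ x ∈ J, x • g = 0) → ∃ s ∈ S, s • g = 0) :
    ∃ r ∈ J, ∀ g : N, r • g = 0 → ∃ s ∈ S, s • g = 0 := by
  have mem_colon {g : N} {r : B} : r ∈ Submodule.colon (⊥ : Submodule B N) {g} ↔ r • g = 0 := by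
    rw [Submodule.mem_colon_singleton, Submodule.mem_bot]
  let T := {p ∈ associatedPrimes B N | Disjoint (S : Set B) p}
  have finite_T : T.Finite := (associatedPrimes.finite B N).subset fun _ hp => hp.1
  have not_subset : ¬ (J : Set B) ⊆ ⋃ p ∈ T, (p : Set B) := by
    intro hsub
    obtain ⟨p, ⟨hp, hpS⟩, hJp⟩ := (Ideal.subset_union_prime_finite finite_T ⊥ ⊥
      fun p hp _ _ => hp.1.isPrime).mp hsub
    obtain ⟨-, g, rfl⟩ := isAssociatedPrime_iff.mp hp
    obtain ⟨s, hs, hsg⟩ := h g fun x hx => mem_colon.mp (hJp hx)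
    exact Set.disjoint_left.mp hpS hs (mem_colon.mpr hsg)
  obtain ⟨r, hrJ, hr⟩ := Set.not_subset.mp not_subset
  refine ⟨r, hrJ, fun g hg => ?_⟩
  by_contra! hno
  obtain ⟨q, hq, hle, hqS⟩ := Ideal.exists_le_prime_disjoint (Submodule.colon ⊥ {g}) S
    (Set.disjoint_left.mpr fun s hs hsS => hno s hsS (mem_colon.mp hs))
  obtain ⟨p, hp, hpq⟩ := Ideal.exists_minimalPrimes_le hle
  obtain ⟨y, hy⟩ := Submodule.exists_eq_colon_of_mem_minimalPrimes hp
  exact hr (Set.mem_biUnion (x := p) ⟨isAssociatedPrime_iff.mpr ⟨hp.isPrime, y, hy⟩,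
    hqS.symm.mono_right hpq⟩ (hp.1.2 (mem_colon.mpr hg)))

theorem exists_isLocRegular [IsNoetherianRing B] (S : Submonoid B) {I J : Ideal B}
    (h : ∀ g, (∀ x ∈ J, x * g ∈ I) → ∃ s ∈ S, s * g ∈ I) : ∃ r ∈ J, IsLocRegular S I r := by
  have smul_mk_eq_zero (r g : B) : r • Ideal.Quotient.mk I g = 0 ↔ r * g ∈ I := by
    rw [← Ideal.Quotient.eq_zero_iff_mem, map_mul]
    rfl
  obtain ⟨r, hrJ, hr⟩ := exists_mem_forall_smul_eq_zero (N := B ⧸ I) S J <|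
    Ideal.Quotient.mk_surjective.forall.mpr <| by simpa only [smul_mk_eq_zero] using h
  exact ⟨r, hrJ, fun g => by simpa only [smul_mk_eq_zero] using hr (Ideal.Quotient.mk I g)⟩

end LocRegular

section KoszulVanishes

variable {B : Type*} [CommRing B] {V : Type*} [LinearOrder V] {S : Submonoid B} {x : V → B}
  {I : Ideal B}

theorem KoszulVanishes.exists_isLocRegular [IsNoetherianRing B] (h : KoszulVanishes S x I 0) :
    ∃ r ∈ Ideal.span (Set.range x), IsLocRegular S I r := by
  refine Reisner.exists_isLocRegular S fun g hg => ?_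
  obtain ⟨s, hs, b, hb⟩ := h (fun _ => g) fun F hF => by
    obtain ⟨v, rfl⟩ := card_eq_one.mp hF
    simpa [koszulD_apply, koszulSign, filter_singleton] using hg (x v) (Ideal.subset_span ⟨v, rfl⟩)
  exact ⟨s, hs, by simpa [koszulD_apply] using hb ∅ rfl⟩

variable [Finite V]

theorem KoszulVanishes.exists_smul_koszulD_sub_mem {i : ℕ} (h : KoszulVanishes S x I (i + 1))
    {r : B} (hr : IsLocRegular S I r) {c : Finset V → B}
    (hc : ∀ F, #F = i + 1 → koszulD x c F ∈ I ⊔ Ideal.span {r}) :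
    ∃ s ∈ S, ∃ f : Finset V → B, ∀ F, #F = i + 1 → koszulD x (s • c - r • f) F ∈ I := by
  have exists_sub_mul_mem (F : Finset V) : ∃ e, #F = i + 1 → koszulD x c F - r * e ∈ I := by
    by_cases hF : #F = i + 1
    · obtain ⟨y, hy, z, hz, hyz⟩ := Submodule.mem_sup.mp (hc F hF)
      obtain ⟨e, rfl⟩ := Ideal.mem_span_singleton'.mp hz
      exact ⟨e, fun _ => by rwa [← hyz, mul_comm r, add_sub_cancel_right]⟩
    · exact ⟨0, fun h => absurd h hF⟩
  choose e he using exists_sub_mul_mem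
  have mul_koszulD_mem (F : Finset V) (hF : #F = i + 1 + 1) : r * koszulD x e F ∈ I := by
    have := koszulD_mem x I (c := koszulD x c - r • e) (F := F)
      fun v hv => he _ (by rw [card_erase_of_mem hv, hF, Nat.add_sub_cancel])
    rwa [map_sub, map_smul, Pi.sub_apply, koszulD_koszulD, zero_sub, neg_mem_iff] at this
  obtain ⟨s, hs, hse⟩ := exists_mem_forall_mul_mem S fun F hF => hr _ (mul_koszulD_mem F hF)
  obtain ⟨s', hs', f, hf⟩ := h (s • e) fun F hF => by
    rw [map_smul]
    exact hse F hF
  refine ⟨s' * s, mul_mem hs' hs, f, fun F hF => ?_⟩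
  have : koszulD x ((s' * s) • c - r • f) F =
      s' * s * (koszulD x c F - r * e F) + r * (s' • (s • e) F - koszulD x f F) := by
    simp only [map_sub, map_smul, Pi.sub_apply, Pi.smul_apply, smul_eq_mul]
    ring
  rw [this]
  exact I.add_mem (I.mul_mem_left _ (he F hF)) (I.mul_mem_left r (hf F hF))

theorem KoszulVanishes.sup_span_singleton {i : ℕ} (h : KoszulVanishes S x I i)
    (h' : KoszulVanishes S x I (i + 1)) {r : B} (hr : IsLocRegular S I r) :
    KoszulVanishes S x (I ⊔ Ideal.span {r}) i := by
  intro c hc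
  obtain ⟨s, hs, f, hf⟩ := h'.exists_smul_koszulD_sub_mem hr hc
  obtain ⟨s', hs', g, hg⟩ := h _ hf
  refine ⟨s' * s, mul_mem hs' hs, g, fun F hF => ?_⟩
  have : (s' * s) • c F - koszulD x g F =
      (s' • (s • c - r • f) F - koszulD x g F) + s' * f F * r := by
    simp only [Pi.sub_apply, Pi.smul_apply, smul_eq_mul]
    ring
  rw [this]
  exact Submodule.add_mem_sup (hg F hF) (Ideal.mul_mem_left _ _ (Ideal.mem_span_singleton_self r))

theorem exists_isLocRegularSeq_of_koszulVanishes [IsNoetherianRing B] {n : ℕ}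
    (h : ∀ i < n, KoszulVanishes S x I i) :
    ∃ rs : List B, rs.length = n ∧ (∀ r ∈ rs, r ∈ Ideal.span (Set.range x)) ∧
      IsLocRegularSeq S I rs := by
  induction n generalizing I with
  | zero => exact ⟨[], rfl, by simp, trivial⟩
  | succ n ih =>
    obtain ⟨r, hrx, hr⟩ := (h 0 n.succ_pos).exists_isLocRegular
    obtain ⟨rs, hlen, hrs, hreg⟩ := ih fun i hi =>
      (h i (by omega)).sup_span_singleton (h (i + 1) (by omega)) hr
    exact ⟨r :: rs, by simp [hlen], List.forall_mem_cons.mpr ⟨hrx, hrs⟩, hr, hreg⟩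

end KoszulVanishes

section Transfer

variable {B : Type*} [CommRing B]

theorem IsLocRegularSeq.of_le {S : Submonoid B} {rs : List B} {I K : Ideal B} (hIK : I ≤ K)
    (hK : ∀ g ∈ K, ∃ s ∈ S, s * g ∈ I) (h : IsLocRegularSeq S K rs) :
    IsLocRegularSeq S I rs := by
  induction rs generalizing I K with
  | nil => trivial
  | cons r rs ih =>
    obtain ⟨hr, hrs⟩ := h
    refine ⟨fun g hg => ?_, ih (sup_le_sup_right hIK _) (fun g hg => ?_) hrs⟩
    · obtain ⟨s, hs, hsg⟩ := hr g (hIK hg)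
      obtain ⟨s', hs', hsg'⟩ := hK _ hsg
      exact ⟨s' * s, mul_mem hs' hs, by rwa [mul_assoc]⟩
    · obtain ⟨y, hy, z, hz, rfl⟩ := Submodule.mem_sup.mp hg
      obtain ⟨s, hs, hsy⟩ := hK y hy
      exact ⟨s, hs, by rw [mul_add]; exact Submodule.add_mem_sup hsy (Ideal.mul_mem_left _ _ hz)⟩

theorem IsLocRegularSeq.getElem {S : Submonoid B} {rs : List B} {I : Ideal B}
    (h : IsLocRegularSeq S I rs) (i : ℕ) (hi : i < rs.length) :
    IsLocRegular S (I ⊔ Ideal.ofList (rs.take i)) rs[i] := by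
  induction rs generalizing I i with
  | nil => exact absurd hi (Nat.not_lt_zero i)
  | cons r rs ih =>
    cases i with
    | zero => simpa using h.1
    | succ i =>
      rw [List.take_succ_cons, Ideal.ofList_cons, ← sup_assoc]
      exact ih h.2 i (by simpa using hi)

section Comap

variable {B' : Type*} [CommRing B'] (φ : B →+* B') {I : Ideal B'}

theorem comap_sup_span_singleton (hφ : ∀ y, ∃ x, y - φ x ∈ I) {x : B} {y : B'}
    (hx : y - φ x ∈ I) :
    (I ⊔ Ideal.span {y}).comap φ = I.comap φ ⊔ Ideal.span {x} := by
  refine le_antisymm (fun g hg => ?_) (sup_le (Ideal.comap_mono le_sup_left) ?_)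
  · obtain ⟨a, ha, b, hb, hab⟩ := Submodule.mem_sup.mp (Ideal.mem_comap.mp hg)
    obtain ⟨c, rfl⟩ := Ideal.mem_span_singleton'.mp hb
    obtain ⟨w, hw⟩ := hφ c
    have : φ (g - w * x) = a + (y * (c - φ w) + φ w * (y - φ x)) := by
      rw [map_sub, map_mul, ← hab]
      ring
    rw [← sub_add_cancel g (w * x)]
    refine Submodule.add_mem_sup ?_ (Ideal.mul_mem_left _ _ (Ideal.mem_span_singleton_self x))
    rw [Ideal.mem_comap, this]
    exact I.add_mem ha (I.add_mem (I.mul_mem_left y hw) (I.mul_mem_left (φ w) hx))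
  · rw [Ideal.span_singleton_le_iff_mem, Ideal.mem_comap, ← sub_sub_cancel y (φ x)]
    exact Ideal.sub_mem _ (Submodule.mem_sup_right (Ideal.mem_span_singleton_self y))
      (Submodule.mem_sup_left hx)

theorem IsLocRegular.comap {M : Ideal B'} [M.IsPrime] (hIM : I ≤ M)
    (hφ : ∀ y, ∃ x, y - φ x ∈ I) {x : B} {y : B'} (hx : y - φ x ∈ I)
    (hy : IsLocRegular M.primeCompl I y) :
    IsLocRegular (M.comap φ).primeCompl (I.comap φ) x := by
  intro g hg
  rw [Ideal.mem_comap, map_mul] at hg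
  obtain ⟨s, hs, hsg⟩ := hy (φ g) <| by
    have := I.add_mem hg (I.mul_mem_right (φ g) hx)
    rwa [sub_mul, add_sub_cancel] at this
  obtain ⟨w, hw⟩ := hφ s
  refine ⟨w, fun hwM => hs ?_, ?_⟩
  · rw [← sub_add_cancel s (φ w)]
    exact M.add_mem (hIM hw) hwM
  · have := I.sub_mem hsg (I.mul_mem_right (φ g) hw)
    rwa [sub_mul, sub_sub_cancel, ← map_mul] at this

theorem IsLocRegularSeq.exists_comap {M : Ideal B'} [M.IsPrime] {rs : List B'} (hIM : I ≤ M)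
    (hφ : ∀ y, ∃ x, y - φ x ∈ I) (hM : ∀ r ∈ rs, r ∈ M)
    (h : IsLocRegularSeq M.primeCompl I rs) :
    ∃ rs' : List B, rs'.length = rs.length ∧ (∀ r ∈ rs', r ∈ M.comap φ) ∧
      IsLocRegularSeq (M.comap φ).primeCompl (I.comap φ) rs' := by
  induction rs generalizing I with
  | nil => exact ⟨[], rfl, by simp, trivial⟩
  | cons y rs ih =>
    obtain ⟨hyM, hM⟩ := List.forall_mem_cons.mp hM
    obtain ⟨x, hx⟩ := hφ y
    obtain ⟨rs', hlen, hmem, hreg⟩ :=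
      ih (sup_le hIM ((Ideal.span_singleton_le_iff_mem M).mpr hyM))
        (fun z => (hφ z).imp fun w hw => Submodule.mem_sup_left hw) hM h.2
    rw [comap_sup_span_singleton φ hφ hx] at hreg
    have hxM : x ∈ M.comap φ := by
      rw [Ideal.mem_comap, ← sub_sub_cancel y (φ x)]
      exact M.sub_mem hyM (hIM hx)
    exact ⟨x :: rs', by simp [hlen], List.forall_mem_cons.mpr ⟨hxM, hmem⟩,
      h.1.comap φ hIM hφ hx, hreg⟩

end Comap

section Localization

variable {I : Ideal B} {T : Submonoid (B ⧸ I)} {A : Type*} [CommRing A] [Algebra (B ⧸ I) A]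
  [IsLocalization T A]

theorem algebraMap_mk_mem_map_iff (J : Ideal B) (b : B) :
    algebraMap (B ⧸ I) A (Ideal.Quotient.mk I b) ∈
        J.map ((algebraMap (B ⧸ I) A).comp (Ideal.Quotient.mk I)) ↔
      ∃ s ∈ T.comap (Ideal.Quotient.mk I), s * b ∈ I ⊔ J := by
  rw [← Ideal.map_map, IsLocalization.algebraMap_mem_map_algebraMap_iff T,
    Ideal.Quotient.mk_surjective.exists]
  simp only [← map_mul, ← Ideal.mem_comap, Submonoid.mem_comap,
    Ideal.comap_map_of_surjective' _ Ideal.Quotient.mk_surjective, Ideal.mk_ker, sup_comm J]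

theorem IsLocRegularSeq.isWeaklyRegular {rs : List B}
    (h : IsLocRegularSeq (T.comap (Ideal.Quotient.mk I)) I rs) :
    RingTheory.Sequence.IsWeaklyRegular A
      (rs.map ((algebraMap (B ⧸ I) A).comp (Ideal.Quotient.mk I))) := by
  set f := (algebraMap (B ⧸ I) A).comp (Ideal.Quotient.mk I)
  refine ⟨fun i hi => ?_⟩
  rw [List.length_map] at hi
  set J := Ideal.ofList (rs.take i)
  have ofList_smul_top : Ideal.ofList ((rs.map f).take i) • (⊤ : Submodule A A) = J.map f := by
    rw [smul_eq_mul, Ideal.mul_top, ← List.map_take, ← Ideal.map_ofList]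
  have mem_map_iff (b : B) : f b ∈ J.map f ↔ ∃ s ∈ T.comap (Ideal.Quotient.mk I), s * b ∈ I ⊔ J :=
    algebraMap_mk_mem_map_iff J b
  rw [ofList_smul_top, List.getElem_map, isSMulRegular_iff_right_eq_zero_of_smul,
    Ideal.Quotient.mk_surjective.forall]
  intro x hx
  obtain ⟨⟨b, s⟩, hbs⟩ := IsLocalization.surj T x
  obtain ⟨b, rfl⟩ := Ideal.Quotient.mk_surjective b
  change x * algebraMap (B ⧸ I) A s = f b at hbs
  have mul_mem : f (rs[i] * b) ∈ J.map f := by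
    rw [map_mul, ← hbs, ← mul_assoc]
    exact Ideal.mul_mem_right _ _ (Ideal.Quotient.eq_zero_iff_mem.mp hx)
  obtain ⟨t, ht, htb⟩ := (mem_map_iff _).mp mul_mem
  obtain ⟨t', ht', htb'⟩ := h.getElem i hi (t * b) (by rwa [mul_left_comm])
  have f_mem : f b ∈ J.map f := (mem_map_iff b).mpr ⟨t' * t, Submonoid.mul_mem _ ht' ht,
    by rwa [mul_assoc]⟩
  rw [← hbs, Ideal.mul_unit_mem_iff_mem _ (IsLocalization.map_units A s)] at f_mem
  exact Ideal.Quotient.eq_zero_iff_mem.mpr f_mem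

end Localization

end Transfer

/-! ### Face rings of links as quotients -/

section Substitution

open MvPolynomial (X C)

variable {V : Type*} {L S : Type*} [CommRing L] [CommRing S]

section SubstVar

variable [DecidableEq V] [Algebra L S]

/-- Extension of the coefficients from `L` to `S` and substitution of `t` for the variable `v`. -/
noncomputable def substVar (v : V) (t : S) : MvPolynomial V L →+* MvPolynomial V S :=
  MvPolynomial.eval₂Hom (C.comp (algebraMap L S)) fun w => if w = v then C t else X w

theorem substVar_C (v : V) (t : S) (a : L) : substVar v t (C a) = C (algebraMap L S a) := by
  simp [substVar]

theorem substVar_X_self (v : V) (t : S) : substVar (L := L) v t (X v) = C t := by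
  simp [substVar]

theorem substVar_X_of_ne {v w : V} (h : w ≠ v) (t : S) :
    substVar (L := L) v t (X w) = X w := by
  simp [substVar, h]

theorem substVar_comp_algebraMap (v : V) (t : S) :
    (substVar v t).comp (algebraMap L (MvPolynomial V L)) =
      (algebraMap S (MvPolynomial V S)).comp (algebraMap L S) :=
  RingHom.ext fun a => substVar_C v t a

theorem substVar_aeval_X_self (v : V) (t : S) (f : Polynomial L) :
    substVar v t (Polynomial.aeval (X v : MvPolynomial V L) f) = C (Polynomial.aeval t f) := by
  rw [Polynomial.aeval_def, Polynomial.hom_eval₂, substVar_X_self, substVar_comp_algebraMap,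
    Polynomial.aeval_def, Polynomial.hom_eval₂]
  rfl

theorem substVar_aeval_X_of_ne {v w : V} (h : w ≠ v) (t : S) (f : Polynomial L) :
    substVar v t (Polynomial.aeval (X w : MvPolynomial V L) f) =
      Polynomial.aeval (X w : MvPolynomial V S) (f.map (algebraMap L S)) := by
  rw [Polynomial.aeval_def, Polynomial.hom_eval₂, substVar_X_of_ne h, substVar_comp_algebraMap,
    Polynomial.aeval_def, Polynomial.eval₂_map]

end SubstVar

variable {Δ : Set (Finset V)}

theorem prod_X_mem_faceIdeal {s : Finset V} (hs : s ∉ Δ) : ∏ i ∈ s, X i ∈ faceIdeal L Δ :=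
  Ideal.subset_span ⟨s, hs, rfl⟩

section Link

variable [DecidableEq V]

theorem X_mem_faceIdeal_lk (v : V) : X v ∈ faceIdeal L (lk Δ {v}) := by
  have : {v} ∉ lk Δ {v} := fun h => (mem_lk_singleton.mp h).1 (mem_singleton_self v)
  simpa using prod_X_mem_faceIdeal (L := L) this

theorem faceIdeal_le_comap_substVar [Algebra L S] (hΔ : IsLowerSet Δ) (v : V) (t : S) :
    faceIdeal L Δ ≤ (faceIdeal S (lk Δ {v})).comap (substVar v t) := by
  refine Ideal.span_le.mpr ?_
  rintro _ ⟨s, hs, rfl⟩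
  rw [SetLike.mem_coe, Ideal.mem_comap, map_prod]
  have prod_erase_mem : ∏ i ∈ s.erase v, substVar v t (X i : MvPolynomial V L) ∈
      faceIdeal S (lk Δ {v}) := by
    rw [prod_congr rfl fun i hi => substVar_X_of_ne (ne_of_mem_erase hi) t]
    exact prod_X_mem_faceIdeal fun h =>
      hs (hΔ (insert_erase_subset v s) (mem_lk_singleton.mp h).2)
  by_cases hv : v ∈ s
  · rw [← mul_prod_erase _ _ hv]
    exact Ideal.mul_mem_left _ _ prod_erase_mem
  · rwa [erase_eq_of_notMem hv] at prod_erase_mem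

section Retraction

variable {v : V} {t : S} {I : Ideal (MvPolynomial V L)} (E : S →+* MvPolynomial V L ⧸ I)

/-- A one-sided inverse of `substVar v t` modulo `I`, given by `E` on coefficients; it sends the
variable `v`, which `substVar v t` eliminates, to zero. -/
noncomputable def unsubstVar (v : V) : MvPolynomial V S →+* MvPolynomial V L ⧸ I :=
  MvPolynomial.eval₂Hom E fun w => if w = v then 0 else Ideal.Quotient.mk I (X w)

theorem mk_X_mul_unsubstVar_eq_zero (hI : faceIdeal L Δ ≤ I) {p : MvPolynomial V S}
    (hp : p ∈ faceIdeal S (lk Δ {v})) :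
    Ideal.Quotient.mk I (X v) * unsubstVar E v p = 0 := by
  induction hp using Submodule.span_induction with
  | mem p hp =>
    obtain ⟨s, hs, rfl⟩ := hp
    by_cases hv : v ∈ s
    · rw [map_prod, prod_eq_zero hv (by simp [unsubstVar]), mul_zero]
    · have unsubstVar_X (i : V) (hi : i ∈ s) :
          unsubstVar E v (X i) = Ideal.Quotient.mk I (X i) := by
        simp [unsubstVar, ne_of_mem_of_not_mem hi hv]
      rw [map_prod, prod_congr rfl unsubstVar_X, ← map_prod, ← map_mul,
        Ideal.Quotient.eq_zero_iff_mem, ← prod_insert hv]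
      exact hI (prod_X_mem_faceIdeal fun h => hs (mem_lk_singleton.mpr ⟨hv, h⟩))
  | zero => simp
  | add p q _ _ hp hq => rw [map_add, mul_add, hp, hq, add_zero]
  | smul a p _ hp => rw [smul_eq_mul, map_mul, mul_left_comm, hp, mul_zero]

variable [Algebra L S]

theorem unsubstVar_substVar (hE : ∀ a, E (algebraMap L S a) = Ideal.Quotient.mk I (C a))
    (ht : E t = Ideal.Quotient.mk I (X v)) (g : MvPolynomial V L) :
    unsubstVar E v (substVar v t g) = Ideal.Quotient.mk I g := by
  suffices (unsubstVar E v).comp (substVar v t) = Ideal.Quotient.mk I from RingHom.congr_fun this g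
  refine MvPolynomial.ringHom_ext (fun a => ?_) fun w => ?_
  · simp [unsubstVar, substVar_C, hE]
  · by_cases hw : w = v
    · subst hw
      simp [unsubstVar, substVar_X_self, ht]
    · simp [unsubstVar, substVar_X_of_ne hw, hw]

theorem X_mul_mem_of_substVar_mem (hI : faceIdeal L Δ ≤ I)
    (hE : ∀ a, E (algebraMap L S a) = Ideal.Quotient.mk I (C a))
    (ht : E t = Ideal.Quotient.mk I (X v)) {g : MvPolynomial V L}
    (hg : substVar v t g ∈ faceIdeal S (lk Δ {v})) : X v * g ∈ I := by
  have := mk_X_mul_unsubstVar_eq_zero E hI hg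
  rwa [unsubstVar_substVar E hE ht, ← map_mul, Ideal.Quotient.eq_zero_iff_mem] at this

end Retraction

theorem X_mul_mem_of_substVar_root_mem (v : V) (f : Polynomial L) {g : MvPolynomial V L}
    (hg : substVar v (AdjoinRoot.root f) g ∈ faceIdeal (AdjoinRoot f) (lk Δ {v})) :
    X v * g ∈ faceIdeal L Δ ⊔ Ideal.span {Polynomial.aeval (X v) f} := by
  set I := faceIdeal L Δ ⊔ Ideal.span {Polynomial.aeval (X v) f}
  refine X_mul_mem_of_substVar_mem (AdjoinRoot.lift ((Ideal.Quotient.mk I).comp C)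
    (Ideal.Quotient.mk I (X v)) ?_) le_sup_left (fun a => ?_) ?_ hg
  · rw [← Polynomial.hom_eval₂]
    exact Ideal.Quotient.eq_zero_iff_mem.mpr
      (Submodule.mem_sup_right (Ideal.mem_span_singleton_self _))
  · rw [AdjoinRoot.algebraMap_eq, AdjoinRoot.lift_of, RingHom.comp_apply]
  · rw [AdjoinRoot.lift_root]

theorem faceIdeal_sup_span_le_comap_substVar_root (hΔ : IsLowerSet Δ) (v : V)
    (f : Polynomial L) :
    faceIdeal L Δ ⊔ Ideal.span {Polynomial.aeval (X v) f} ≤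
      (faceIdeal (AdjoinRoot f) (lk Δ {v})).comap (substVar v (AdjoinRoot.root f)) := by
  refine sup_le (faceIdeal_le_comap_substVar hΔ v _) ?_
  rw [Ideal.span_singleton_le_iff_mem, Ideal.mem_comap, substVar_aeval_X_self,
    AdjoinRoot.aeval_eq, AdjoinRoot.mk_self, map_zero]
  exact Ideal.zero_mem _

theorem exists_sub_substVar_root_mem (v : V) (f : Polynomial L)
    (y : MvPolynomial V (AdjoinRoot f)) : ∃ x : MvPolynomial V L,
      y - substVar v (AdjoinRoot.root f) x ∈ faceIdeal (AdjoinRoot f) (lk Δ {v}) := by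
  induction y using MvPolynomial.induction_on with
  | C a =>
    obtain ⟨p, rfl⟩ := AdjoinRoot.mk_surjective a
    refine ⟨Polynomial.aeval (X v) p, ?_⟩
    rw [substVar_aeval_X_self, AdjoinRoot.aeval_eq, sub_self]
    exact Ideal.zero_mem _
  | add p q hp hq =>
    obtain ⟨x, hx⟩ := hp
    obtain ⟨x', hx'⟩ := hq
    refine ⟨x + x', ?_⟩
    rw [map_add, ← sub_add_sub_comm]
    exact Ideal.add_mem _ hx hx'
  | mul_X p w hp =>
    by_cases hw : w = v
    · subst hw
      refine ⟨0, ?_⟩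
      rw [map_zero, sub_zero]
      exact Ideal.mul_mem_left _ _ (X_mem_faceIdeal_lk w)
    · obtain ⟨x, hx⟩ := hp
      refine ⟨x * X w, ?_⟩
      rw [map_mul, substVar_X_of_ne hw, ← sub_mul]
      exact Ideal.mul_mem_right _ _ hx

end Link

theorem X_mul_mem_of_aeval_mul_mem (hΔ : IsLowerSet Δ) (v : V) {f : Polynomial L} (hf : f.Monic)
    {g : MvPolynomial V L} (hg : Polynomial.aeval (X v) f * g ∈ faceIdeal L Δ) :
    X v * g ∈ faceIdeal L Δ := by
  classical
  refine X_mul_mem_of_substVar_mem (S := Polynomial L) (t := Polynomial.X)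
    (Polynomial.eval₂RingHom ((Ideal.Quotient.mk _).comp C) (Ideal.Quotient.mk _ (X v)))
    le_rfl (fun a => by simp) (by simp) ?_
  have h := faceIdeal_le_comap_substVar hΔ v (Polynomial.X : Polynomial L) hg
  rw [Ideal.mem_comap, map_mul, substVar_aeval_X_self, Polynomial.aeval_X_left_apply,
    mem_faceIdeal_iff (isLowerSet_lk hΔ _)] at h
  rw [mem_faceIdeal_iff (isLowerSet_lk hΔ _)]
  intro m hm
  have := h m hm
  rw [MvPolynomial.coeff_C_mul] at this
  exact hf.mul_right_eq_zero_iff.mp this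

end Substitution

section Existence

open MvPolynomial (X)

theorem exists_isPrime_comap_eq {B B' : Type*} [CommRing B] [CommRing B'] {φ : B →+* B'}
    {I : Ideal B'} (hφ : ∀ y, ∃ x, y - φ x ∈ I) {M : Ideal B} [M.IsPrime] (hM : I.comap φ ≤ M) :
    ∃ M' : Ideal B', M'.IsPrime ∧ I ≤ M' ∧ M'.comap φ = M := by
  let π := (Ideal.Quotient.mk I).comp φ
  have surjective_π : Function.Surjective π := Ideal.Quotient.mk_surjective.forall.mpr fun y =>
    (hφ y).imp fun x hx => (Ideal.Quotient.eq.mpr hx).symm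
  have ker_π : RingHom.ker π = I.comap φ := by
    ext g
    exact Ideal.Quotient.eq_zero_iff_mem
  have : (M.map π).IsPrime := Ideal.map_isPrime_of_surjective surjective_π (ker_π ▸ hM)
  refine ⟨(M.map π).comap (Ideal.Quotient.mk I), inferInstance, fun y hy => ?_, ?_⟩
  · rw [Ideal.mem_comap, Ideal.Quotient.eq_zero_iff_mem.mpr hy]
    exact Ideal.zero_mem _
  · rw [Ideal.comap_comap, Ideal.comap_map_of_surjective' π surjective_π, ker_π,
      sup_eq_left.mpr hM]

variable {V : Type*} {L : Type v} [CommRing L] {Δ : Set (Finset V)}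

theorem exists_monic_aeval_X_mem_of_comap_substVar [DecidableEq V] {v : V} {f : Polynomial L}
    {M : Ideal (MvPolynomial V L)} {M' : Ideal (MvPolynomial V (AdjoinRoot f))}
    (hM' : faceIdeal (AdjoinRoot f) (lk Δ {v}) ≤ M')
    (hcomap : M'.comap (substVar v (AdjoinRoot.root f)) = M)
    (hint : ∀ w, ∃ p : Polynomial L, p.Monic ∧ Polynomial.aeval (X w) p ∈ M) (w : V) :
    ∃ p : Polynomial (AdjoinRoot f), p.Monic ∧ Polynomial.aeval (X w) p ∈ M' := by
  by_cases hw : w = v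
  · refine ⟨Polynomial.X, Polynomial.monic_X, ?_⟩
    rw [Polynomial.aeval_X, hw]
    exact hM' (X_mem_faceIdeal_lk v)
  · obtain ⟨p, hp, hpM⟩ := hint w
    refine ⟨p.map (algebraMap L (AdjoinRoot f)), hp.map _, ?_⟩
    rwa [← substVar_aeval_X_of_ne hw (AdjoinRoot.root f), ← Ideal.mem_comap, hcomap]

/-- Locally at `M` the polynomial `f (X v)` is regular on the face ring of `Δ`, with quotient the
face ring of the link of `v` over `AdjoinRoot f`. -/
theorem exists_isLocRegularSeq_faceIdeal_of_lk [DecidableEq V] (hΔ : IsLowerSet Δ)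
    {M : Ideal (MvPolynomial V L)} [M.IsPrime] (hM : faceIdeal L Δ ≤ M) {v : V} (hv : X v ∉ M)
    {f : Polynomial L} (hf : f.Monic) (hfM : Polynomial.aeval (X v) f ∈ M) {d : ℕ}
    (h : ∀ (M' : Ideal (MvPolynomial V (AdjoinRoot f))) [M'.IsPrime],
      faceIdeal (AdjoinRoot f) (lk Δ {v}) ≤ M' → M'.comap (substVar v (AdjoinRoot.root f)) = M →
      ∃ rs : List (MvPolynomial V (AdjoinRoot f)), rs.length = d ∧ (∀ r ∈ rs, r ∈ M') ∧
        IsLocRegularSeq M'.primeCompl (faceIdeal (AdjoinRoot f) (lk Δ {v})) rs) :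
    ∃ rs : List (MvPolynomial V L), rs.length = d + 1 ∧ (∀ r ∈ rs, r ∈ M) ∧
      IsLocRegularSeq M.primeCompl (faceIdeal L Δ) rs := by
  have sup_le_M : faceIdeal L Δ ⊔ Ideal.span {Polynomial.aeval (X v) f} ≤ M :=
    sup_le hM ((Ideal.span_singleton_le_iff_mem M).mpr hfM)
  have surjective_mod := exists_sub_substVar_root_mem (Δ := Δ) v f
  obtain ⟨M', _, hM', rfl⟩ := exists_isPrime_comap_eq surjective_mod fun g hg =>
    (Ideal.IsPrime.mem_or_mem ‹M.IsPrime›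
      (sup_le_M (X_mul_mem_of_substVar_root_mem v f hg))).resolve_left hv
  obtain ⟨rs', hlen', hrs', hreg'⟩ := h M' hM' rfl
  obtain ⟨rs, hlen, hrs, hreg⟩ := hreg'.exists_comap _ hM' surjective_mod hrs'
  exact ⟨Polynomial.aeval (X v) f :: rs, by simp [hlen, hlen'],
    List.forall_mem_cons.mpr ⟨hfM, hrs⟩,
    fun g hg => ⟨X v, hv, X_mul_mem_of_aeval_mul_mem hΔ v hf hg⟩,
    hreg.of_le (faceIdeal_sup_span_le_comap_substVar_root hΔ v f)
      fun g hg => ⟨X v, hv, X_mul_mem_of_substVar_root_mem v f hg⟩⟩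

variable [LinearOrder V]

theorem forall_acyclicAt_lk_lk_singleton {k : Type*} [CommRing k] (hΔ : IsLowerSet Δ) (v : V)
    {d : ℕ}
    (H : ∀ (G : Finset V) (n : ℕ), n + #G < d + 1 → AcyclicAt k (lk Δ G) n)
    (G : Finset V) (n : ℕ) (hn : n + #G < d) : AcyclicAt k (lk (lk Δ {v}) G) n := by
  by_cases hv : v ∈ G
  · rw [lk_eq_empty (isLowerSet_lk hΔ {v}) fun h => (mem_lk_singleton.mp h).1 hv]
    exact acyclicAt_empty k n
  · rw [lk_lk_singleton hv]
    exact H _ _ (by rw [card_insert_of_notMem hv]; omega)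

variable [Finite V] [IsNoetherianRing L]

theorem exists_isLocRegularSeq_faceIdeal_of_X_mem {k : Type*} [CommRing k] [Algebra k L]
    [Module.Free k L] (hΔ : IsLowerSet Δ) {d : ℕ}
    (H : ∀ (G : Finset V) (n : ℕ), n + #G < d → AcyclicAt k (lk Δ G) n)
    {M : Ideal (MvPolynomial V L)} [M.IsPrime] (hX : ∀ v, X v ∈ M) :
    ∃ rs : List (MvPolynomial V L), rs.length = d ∧ (∀ r ∈ rs, r ∈ M) ∧
      IsLocRegularSeq M.primeCompl (faceIdeal L Δ) rs := by
  have vanishes (i : ℕ) (hi : i < d) :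
      KoszulVanishes M.primeCompl (X : V → MvPolynomial V L) (faceIdeal L Δ) i := by
    refine .mono bot_le ((koszulVanishes_faceIdeal_iff hΔ i).mpr fun G n hn => ?_)
    exact ((forall_acyclicAt_lk_iff_forall_acyclicAt_del hΔ d).mp H G n (hn ▸ hi)).baseChange
  obtain ⟨rs, hlen, hrs, hreg⟩ := exists_isLocRegularSeq_of_koszulVanishes vanishes
  have span_le : Ideal.span (Set.range X) ≤ M := Ideal.span_le.mpr (Set.range_subset_iff.mpr hX)
  exact ⟨rs, hlen, fun r hr => span_le (hrs r hr), hreg⟩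

/-- The ring `L` is arbitrary so that the induction can replace it by `AdjoinRoot f`. -/
theorem exists_isLocRegularSeq_faceIdeal {k : Type*} [Field k] [Algebra k L]
    (hΔ : IsLowerSet Δ) {d : ℕ}
    (H : ∀ (G : Finset V) (n : ℕ), n + #G < d → AcyclicAt k (lk Δ G) n)
    {M : Ideal (MvPolynomial V L)} [M.IsPrime] (hM : faceIdeal L Δ ≤ M)
    (hint : ∀ v, ∃ f : Polynomial L, f.Monic ∧ Polynomial.aeval (X v) f ∈ M) :
    ∃ rs : List (MvPolynomial V L), rs.length = d ∧ (∀ r ∈ rs, r ∈ M) ∧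
      IsLocRegularSeq M.primeCompl (faceIdeal L Δ) rs := by
  induction d generalizing L Δ with
  | zero => exact ⟨[], rfl, by simp, trivial⟩
  | succ d ih =>
    by_cases hX : ∀ v, X v ∈ M
    · exact exists_isLocRegularSeq_faceIdeal_of_X_mem hΔ H hX
    obtain ⟨v, hv⟩ := not_forall.mp hX
    obtain ⟨f, hf, hfM⟩ := hint v
    exact exists_isLocRegularSeq_faceIdeal_of_lk hΔ hM hv hf hfM fun M' _ hM' hcomap =>
      ih (isLowerSet_lk hΔ {v}) (forall_acyclicAt_lk_lk_singleton hΔ v H) hM'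
        (exists_monic_aeval_X_mem_of_comap_substVar hM' hcomap hint)

end Existence

/-! ### Krull dimension of a face ring -/

section Dimension

open MvPolynomial (X C)

theorem ringKrullDim_le_of_forall_isPrime {A : Type*} [CommRing A] {d : WithBot ℕ∞}
    (h : ∀ q : Ideal A, q.IsPrime → ringKrullDim (A ⧸ q) ≤ d) : ringKrullDim A ≤ d := by
  rw [ringKrullDim, Order.krullDim_eq_iSup_coheight]
  refine iSup_le fun q => ?_
  rw [Order.coheight_eq_krullDim_Ici]
  exact (ringKrullDim_quotient q.asIdeal).symm.trans_le (h q.asIdeal q.isPrime)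

theorem ringKrullDim_le_card_of_surjective {k A V : Type*} [Field k] [CommRing A] [Algebra k A]
    {π : MvPolynomial V k →ₐ[k] A} (hπ : Function.Surjective π) {F : Finset V}
    (hF : ∀ v ∉ F, π (X v) = 0) : ringKrullDim A ≤ #F := by
  let f : MvPolynomial F k →ₐ[k] A := MvPolynomial.aeval fun v => π (X v)
  have range_f : f.range = ⊤ := by
    rw [eq_top_iff, ← (AlgHom.range_eq_top π).mpr hπ, ← Algebra.map_top,
      ← MvPolynomial.adjoin_range_X, AlgHom.map_adjoin, Algebra.adjoin_le_iff]
    rintro _ ⟨_, ⟨v, rfl⟩, rfl⟩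
    by_cases hv : v ∈ F
    · exact ⟨X ⟨v, hv⟩, by simp [f]⟩
    · exact hF v hv ▸ zero_mem _
  refine (ringKrullDim_le_of_surjective f.toRingHom ((AlgHom.range_eq_top f).mp range_f)).trans ?_
  rw [MvPolynomial.ringKrullDim_of_isNoetherianRing, ringKrullDim_eq_zero_of_field, zero_add,
    Nat.card_eq_fintype_card, Fintype.card_coe]

variable {V : Type*} {L : Type*} [CommRing L] {Δ : Set (Finset V)}

theorem ringKrullDim_quotient_faceIdeal_le [Finite V] {k : Type*} [Field k] {d : ℕ}
    (hd : ∀ F ∈ Δ, #F ≤ d) : ringKrullDim (MvPolynomial V k ⧸ faceIdeal k Δ) ≤ d := by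
  classical
  cases nonempty_fintype V
  refine ringKrullDim_le_of_forall_isPrime fun q hq => ?_
  let π : MvPolynomial V k →ₐ[k] (MvPolynomial V k ⧸ faceIdeal k Δ) ⧸ q :=
    (Ideal.Quotient.mkₐ k q).comp (Ideal.Quotient.mkₐ k (faceIdeal k Δ))
  have surjective_π : Function.Surjective π :=
    Ideal.Quotient.mk_surjective.comp Ideal.Quotient.mk_surjective
  let F : Finset V := {v | π (X v) ≠ 0}
  have F_mem : F ∈ Δ := by
    by_contra hF
    have prod_eq_zero : ∏ v ∈ F, π (X v) = 0 := by
      rw [← map_prod, AlgHom.comp_apply, Ideal.Quotient.mkₐ_eq_mk k (faceIdeal k Δ),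
        Ideal.Quotient.eq_zero_iff_mem.mpr (prod_X_mem_faceIdeal hF), map_zero]
    obtain ⟨v, hv, hπv⟩ := prod_eq_zero_iff.mp prod_eq_zero
    exact (mem_filter.mp hv).2 hπv
  refine (ringKrullDim_le_card_of_surjective surjective_π (F := F) ?_).trans ?_
  · simp [F]
  · exact_mod_cast hd F F_mem

theorem ker_constantCoeff :
    RingHom.ker (MvPolynomial.constantCoeff : MvPolynomial V L →+* L) =
      MvPolynomial.idealOfVars V L := by
  ext p
  rw [RingHom.mem_ker, ← pow_one (MvPolynomial.idealOfVars V L),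
    MvPolynomial.mem_pow_idealOfVars_iff']
  simp [Finsupp.degree_eq_zero_iff, MvPolynomial.constantCoeff_eq]

theorem X_mem_span_X_image_iff [Nontrivial L] {s : Set V} {v : V} :
    (X v : MvPolynomial V L) ∈ Ideal.span (X '' s) ↔ v ∈ s := by
  classical
  simp [MvPolynomial.mem_ideal_span_X_image, MvPolynomial.support_X, Finsupp.single_apply]

theorem isPrime_span_X_image [IsDomain L] (s : Set V) :
    (Ideal.span (X '' s : Set (MvPolynomial V L))).IsPrime := by
  classical
  let J := Ideal.span (X '' s : Set (MvPolynomial V L))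
  let φ : MvPolynomial V L →ₐ[L] MvPolynomial V L :=
    MvPolynomial.aeval fun v => if v ∈ s then 0 else X v
  have mk_φ : (Ideal.Quotient.mkₐ L J).comp φ = Ideal.Quotient.mkₐ L J := by
    refine MvPolynomial.algHom_ext fun v => ?_
    by_cases hv : v ∈ s
    · simpa [φ, hv] using (Ideal.Quotient.eq_zero_iff_mem.mpr
        (Ideal.subset_span (Set.mem_image_of_mem X hv))).symm
    · simp [φ, hv]
  have J_eq_ker : J = RingHom.ker φ := by
    refine le_antisymm (Ideal.span_le.mpr ?_) fun p hp => ?_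
    · rintro _ ⟨v, hv, rfl⟩
      simp [φ, hv]
    · rw [← Ideal.Quotient.eq_zero_iff_mem, ← Ideal.Quotient.mkₐ_eq_mk L, ← mk_φ,
        AlgHom.comp_apply, RingHom.mem_ker.mp hp, map_zero]
  exact (J_eq_ker ▸ RingHom.ker_isPrime φ : J.IsPrime)

theorem faceIdeal_le_span_X_image_compl (hΔ : IsLowerSet Δ) {D : Finset V} (hD : D ∈ Δ) :
    faceIdeal L Δ ≤ Ideal.span (X '' (D : Set V)ᶜ) := by
  refine Ideal.span_le.mpr ?_
  rintro _ ⟨s, hs, rfl⟩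
  obtain ⟨v, hv, hvD⟩ := not_subset.mp fun h : s ⊆ D => hs (hΔ h hD)
  exact Ideal.mem_of_dvd _ (dvd_prod_of_mem X hv) (Ideal.subset_span ⟨v, hvD, rfl⟩)

theorem card_le_height_map_span_X_image [IsDomain L] {I : Ideal (MvPolynomial V L)} {s : Set V}
    (hI : I ≤ Ideal.span (X '' s)) {t : Finset V} (hst : Disjoint s t) :
    (#t : ℕ∞) ≤ ((Ideal.span (X '' (s ∪ t))).map (Ideal.Quotient.mk I)).height := by
  classical
  have le_span (t : Finset V) : I ≤ Ideal.span (X '' (s ∪ t)) :=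
    hI.trans (Ideal.span_mono (Set.image_mono Set.subset_union_left))
  have isPrime_map (t : Finset V) :
      ((Ideal.span (X '' (s ∪ t))).map (Ideal.Quotient.mk I)).IsPrime :=
    have := isPrime_span_X_image (L := L) (s ∪ t)
    Ideal.map_isPrime_of_surjective Ideal.Quotient.mk_surjective
      ((Ideal.mk_ker (I := I)).trans_le (le_span t))
  induction t using Finset.induction_on with
  | empty => exact bot_le
  | insert v t hv ih =>
    have map_lt_map : (Ideal.span (X '' (s ∪ t))).map (Ideal.Quotient.mk I) <
        (Ideal.span (X '' (s ∪ ↑(insert v t)))).map (Ideal.Quotient.mk I) := by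
      refine lt_of_le_not_ge (Ideal.map_mono (Ideal.span_mono (Set.image_mono
        (Set.union_subset_union_right s (coe_subset.mpr (subset_insert v t)))))) fun hle => ?_
      have := Ideal.comap_mono (f := Ideal.Quotient.mk I) hle
      rw [Ideal.comap_map_mk (le_span _), Ideal.comap_map_mk (le_span _)] at this
      have := X_mem_span_X_image_iff.mp (this (X_mem_span_X_image_iff (v := v).mpr (by simp)))
      simp_all
    rw [card_insert_of_notMem hv, Nat.cast_add, Nat.cast_one]
    exact (add_le_add_left (ih (hst.mono_right (coe_subset.mpr (subset_insert v t)))) 1).trans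
      (Ideal.height_add_one_le_of_lt_of_isPrime map_lt_map)

theorem card_le_height_map_idealOfVars [IsDomain L] (hΔ : IsLowerSet Δ) {D : Finset V}
    (hD : D ∈ Δ) : (#D : ℕ∞) ≤
      ((MvPolynomial.idealOfVars V L).map (Ideal.Quotient.mk (faceIdeal L Δ))).height := by
  simpa using card_le_height_map_span_X_image (faceIdeal_le_span_X_image_compl (L := L) hΔ hD)
    disjoint_compl_left

end Dimension

/-! ### The Cohen–Macaulay property -/

section LocalDepth

variable {A : Type*} [CommRing A] [IsLocalRing A]

theorem lt_localDepth_iff {n : ℕ} : (n : ℕ∞) < localDepth A ↔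
    ∃ rs : List A, RingTheory.Sequence.IsRegular A rs ∧
      (∀ r ∈ rs, r ∈ IsLocalRing.maximalIdeal A) ∧ n < rs.length := by
  simp [localDepth, lt_iSup_iff, and_assoc]

theorem length_le_localDepth {rs : List A} (h : RingTheory.Sequence.IsWeaklyRegular A rs)
    (hrs : ∀ r ∈ rs, r ∈ IsLocalRing.maximalIdeal A) : (rs.length : ℕ∞) ≤ localDepth A :=
  le_iSup (fun rs : {rs : List A // RingTheory.Sequence.IsRegular A rs ∧
    ∀ r ∈ rs, r ∈ IsLocalRing.maximalIdeal A} => (rs.1.length : ℕ∞))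
    ⟨rs, (IsLocalRing.isRegular_iff_isWeaklyRegular_of_subset_maximalIdeal hrs).mpr h, hrs⟩

variable [IsNoetherianRing A]

theorem length_le_ringKrullDim {rs : List A} (h : RingTheory.Sequence.IsRegular A rs) :
    (rs.length : WithBot ℕ∞) ≤ ringKrullDim A := by
  rw [← ringKrullDim_add_length_eq_ringKrullDim_of_isRegular rs h]
  have ofList_ne_top : Ideal.ofList rs ≠ ⊤ := fun e => h.top_ne_smul (by simp [e])
  have := Ideal.Quotient.nontrivial_iff.mpr ofList_ne_top
  exact le_add_of_nonneg_left ringKrullDim_nonneg_of_nontrivial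

theorem localDepth_le_ringKrullDim : (localDepth A : WithBot ℕ∞) ≤ ringKrullDim A := by
  obtain ⟨d, hd⟩ := WithBot.ne_bot_iff_exists.mp (ringKrullDim_ne_bot (R := A))
  rw [← hd, WithBot.coe_le_coe]
  refine iSup_le fun rs => WithBot.coe_le_coe.mp ?_
  exact (length_le_ringKrullDim rs.2.1).trans_eq hd.symm

end LocalDepth

section KoszulVanishes

variable {V : Type*} [LinearOrder V]

theorem KoszulVanishes.of_isLocalization [Finite V] {B : Type*} [CommRing B] {I : Ideal B}
    (T : Submonoid (B ⧸ I)) {A : Type*} [CommRing A] [Algebra (B ⧸ I) A] [IsLocalization T A]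
    {x : V → B} {i : ℕ} (h : KoszulVanishes ⊥
      (fun v => (algebraMap (B ⧸ I) A).comp (Ideal.Quotient.mk I) (x v)) (⊥ : Submodule A A) i) :
    KoszulVanishes (T.comap (Ideal.Quotient.mk I)) x I i := by
  set f := (algebraMap (B ⧸ I) A).comp (Ideal.Quotient.mk I)
  have eq_zero_iff (b : B) : f b = 0 ↔ ∃ s ∈ T.comap (Ideal.Quotient.mk I), s * b ∈ I := by
    simpa [f] using algebraMap_mk_mem_map_iff (T := T) (A := A) ⊥ b
  intro c hc
  obtain ⟨b, hb⟩ := koszulVanishes_bot_iff.mp h (fun F => f (c F)) fun F hF => by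
    rw [koszulD_ringHom, Submodule.mem_bot, eq_zero_iff]
    exact ⟨1, Submonoid.one_mem _, I.mul_mem_left 1 (hc F hF)⟩
  obtain ⟨⟨s, hs⟩, hsb⟩ := IsLocalization.exist_integer_multiples_of_finite T b
  obtain ⟨s, rfl⟩ := Ideal.Quotient.mk_surjective s
  have exists_numerator (F : Finset V) : ∃ a, f a = f s * b F := by
    obtain ⟨a, ha⟩ := hsb F
    obtain ⟨a, rfl⟩ := Ideal.Quotient.mk_surjective a
    exact ⟨a, ha.trans (Algebra.smul_def _ _)⟩
  choose b' hb' using exists_numerator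
  have map_koszulD (F : Finset V) : f (koszulD x b' F) = f s * koszulD (fun v => f (x v)) b F := by
    rw [← koszulD_ringHom, show (fun G => f (b' G)) = f s • b from funext hb', map_smul,
      Pi.smul_apply, smul_eq_mul]
  obtain ⟨t, ht, htI⟩ := exists_mem_forall_mul_mem (T.comap (Ideal.Quotient.mk I)) (I := I)
    (g := s • c - koszulD x b') (p := fun F => #F = i) fun F hF => (eq_zero_iff _).mp <| by
      rw [Pi.sub_apply, map_sub, map_koszulD, ← sub_eq_zero.mp (hb F hF), Pi.smul_apply,
        smul_eq_mul, map_mul, sub_self]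
  refine ⟨t * s, Submonoid.mul_mem _ ht hs, t • b', fun F hF => ?_⟩
  rw [map_smul, mul_smul]
  simpa only [Pi.sub_apply, Pi.smul_apply, smul_eq_mul, mul_sub] using htI F hF

variable {k : Type*} [Field k] {I : Ideal (MvPolynomial V k)}

theorem KoszulVanishes.of_constantCoeff_ne_zero {S : Submonoid (MvPolynomial V k)} {i : ℕ}
    (h : KoszulVanishes S MvPolynomial.X I i)
    (hS : ∀ s ∈ S, MvPolynomial.constantCoeff s ≠ 0) :
    KoszulVanishes ⊥ MvPolynomial.X I i :=
  h.of_isUnit_mod_span fun s hs => by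
    refine ⟨MvPolynomial.C (MvPolynomial.constantCoeff s)⁻¹, ?_⟩
    change _ ∈ MvPolynomial.idealOfVars V k
    rw [← ker_constantCoeff, RingHom.mem_ker]
    simp [inv_mul_cancel₀ (hS s hs)]

theorem koszulVanishes_of_lt_localDepth [Finite V]
    [((MvPolynomial.idealOfVars V k).map (Ideal.Quotient.mk I)).IsPrime] {i : ℕ}
    (hi : i < localDepth (Localization.AtPrime
      ((MvPolynomial.idealOfVars V k).map (Ideal.Quotient.mk I)))) :
    KoszulVanishes ⊥ MvPolynomial.X I i := by
  set M := (MvPolynomial.idealOfVars V k).map (Ideal.Quotient.mk I)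
  set f := (algebraMap _ (Localization.AtPrime M)).comp (Ideal.Quotient.mk I)
  have maximalIdeal_eq : IsLocalRing.maximalIdeal (Localization.AtPrime M) =
      Ideal.span (Set.range fun v => f (MvPolynomial.X v)) := by
    rw [← Localization.AtPrime.map_eq_maximalIdeal, Ideal.map_map, Ideal.map_span,
      ← Set.range_comp]
    rfl
  obtain ⟨rs, regular_rs, hrs, hlen⟩ := lt_localDepth_iff.mp hi
  have koszul_localization := koszulVanishes_of_isWeaklyRegular regular_rs.toIsWeaklyRegular
    (fun r hr => maximalIdeal_eq ▸ hrs r hr) hlen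
  refine (koszul_localization.of_isLocalization M.primeCompl).of_constantCoeff_ne_zero
    fun s hs hs0 => hs ?_
  rw [← RingHom.mem_ker, ker_constantCoeff] at hs0
  exact Ideal.mem_map_of_mem _ hs0

end KoszulVanishes

section Criterion

variable {V : Type*} [Finite V] {k : Type*} [Field k] {Δ : Set (Finset V)}

/-- By Zariski's lemma the residue field at a maximal ideal is algebraic over `k`. -/
theorem exists_monic_aeval_X_mem (M : Ideal (MvPolynomial V k)) [M.IsMaximal] (v : V) :
    ∃ f : Polynomial k, f.Monic ∧ Polynomial.aeval (MvPolynomial.X v) f ∈ M := by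
  let _ := Ideal.Quotient.field M
  have : Module.Finite k (MvPolynomial V k ⧸ M) := finite_of_finite_type_of_isJacobsonRing k _
  obtain ⟨f, hf, hfv⟩ := Algebra.IsIntegral.isIntegral (R := k)
    (Ideal.Quotient.mkₐ k M (MvPolynomial.X v))
  refine ⟨f, hf, ?_⟩
  rwa [← Polynomial.aeval_def, Polynomial.aeval_algHom_apply, Ideal.Quotient.mkₐ_eq_mk,
    Ideal.Quotient.eq_zero_iff_mem] at hfv

variable [LinearOrder V]

theorem le_localDepth_of_forall_acyclicAt_lk (hΔ : IsLowerSet Δ) {d : ℕ}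
    (H : ∀ G n, n + #G < d → AcyclicAt k (lk Δ G) n)
    (M : Ideal (MvPolynomial V k ⧸ faceIdeal k Δ)) [M.IsMaximal] :
    (d : ℕ∞) ≤ localDepth (Localization.AtPrime M) := by
  have isMaximal_comap : (M.comap (Ideal.Quotient.mk (faceIdeal k Δ))).IsMaximal :=
    Ideal.comap_isMaximal_of_surjective _ Ideal.Quotient.mk_surjective
  obtain ⟨rs, rfl, hrs, regular_rs⟩ := exists_isLocRegularSeq_faceIdeal (L := k) hΔ H
    (M := M.comap (Ideal.Quotient.mk (faceIdeal k Δ)))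
    (Ideal.mk_ker.ge.trans (Ideal.comap_mono bot_le)) (exists_monic_aeval_X_mem _)
  rw [← List.length_map (f := (algebraMap _ (Localization.AtPrime M)).comp
    (Ideal.Quotient.mk (faceIdeal k Δ)))]
  refine length_le_localDepth (IsLocRegularSeq.isWeaklyRegular (T := M.primeCompl) regular_rs) ?_
  rw [← Localization.AtPrime.map_eq_maximalIdeal, List.forall_mem_map]
  exact fun r hr => Ideal.mem_map_of_mem _ (hrs r hr)

theorem isCohenMacaulay_of_forall_acyclicAt_lk (hΔ : IsLowerSet Δ) {d : ℕ}
    (hd : ∀ F ∈ Δ, #F ≤ d) (H : ∀ G n, n + #G < d → AcyclicAt k (lk Δ G) n) :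
    IsCohenMacaulay (MvPolynomial V k ⧸ faceIdeal k Δ) where
  isNoetherianRing := inferInstance
  depth_eq_dim M _ := by
    have : M.IsPrime := Ideal.IsMaximal.isPrime inferInstance
    refine le_antisymm localDepth_le_ringKrullDim ?_
    calc ringKrullDim (Localization.AtPrime M) = M.height :=
          IsLocalization.AtPrime.ringKrullDim_eq_height M (Localization.AtPrime M)
      _ ≤ ringKrullDim (MvPolynomial V k ⧸ faceIdeal k Δ) :=
          Ideal.height_le_ringKrullDim_of_isPrime
      _ ≤ d := ringKrullDim_quotient_faceIdeal_le hd
      _ ≤ localDepth (Localization.AtPrime M) :=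
          WithBot.coe_le_coe.mpr (le_localDepth_of_forall_acyclicAt_lk hΔ H M)

theorem IsCohenMacaulay.acyclicAt_lk (h : IsCohenMacaulay (MvPolynomial V k ⧸ faceIdeal k Δ))
    (hΔ : IsLowerSet Δ) {D : Finset V} (hD : D ∈ Δ) {G : Finset V} {n : ℕ} (hn : n + #G < #D) :
    AcyclicAt k (lk Δ G) n := by
  have faceIdeal_le : faceIdeal k Δ ≤ MvPolynomial.idealOfVars V k :=
    (faceIdeal_le_span_X_image_compl hΔ hD).trans (Ideal.span_mono (Set.image_subset_range ..))
  set M := (MvPolynomial.idealOfVars V k).map (Ideal.Quotient.mk (faceIdeal k Δ))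
  have isMaximal_M : M.IsMaximal :=
    have : (MvPolynomial.idealOfVars V k).IsMaximal := ker_constantCoeff (V := V) (L := k) ▸
      RingHom.ker_isMaximal_of_surjective _ fun a => ⟨MvPolynomial.C a, by simp⟩
    Ideal.IsMaximal.map_of_surjective_of_ker_le Ideal.Quotient.mk_surjective
      (Ideal.mk_ker.trans_le faceIdeal_le)
  have le_localDepth : (#D : ℕ∞) ≤ localDepth (Localization.AtPrime M) := by
    rw [← WithBot.coe_le_coe, h.depth_eq_dim M,
      IsLocalization.AtPrime.ringKrullDim_eq_height M (Localization.AtPrime M), WithBot.coe_le_coe]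
    exact card_le_height_map_idealOfVars hΔ hD
  refine (forall_acyclicAt_lk_iff_forall_acyclicAt_del hΔ #D).mpr (fun H m hm => ?_) G n hn
  refine (koszulVanishes_faceIdeal_iff hΔ (m + #H)).mp ?_ H m rfl
  exact koszulVanishes_of_lt_localDepth ((Nat.cast_lt.mpr hm).trans_le le_localDepth)

theorem isCohenMacaulay_iff_linksAcyclic (hΔ : IsLowerSet Δ) (hne : Δ.Nonempty) :
    IsCohenMacaulay (MvPolynomial V k ⧸ faceIdeal k Δ) ↔ LinksAcyclic k Δ := by
  obtain ⟨D, hD, card_le⟩ := Set.exists_max_image Δ card Δ.toFinite hne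
  refine ⟨fun h G _ F hF n hn => h.acyclicAt_lk hΔ hD ?_, fun h =>
    isCohenMacaulay_of_forall_acyclicAt_lk hΔ card_le (h.acyclicAt_lk hΔ card_le ⟨D, hD, rfl⟩)⟩
  have := card_le _ hF.2
  rw [card_union_of_disjoint hF.1] at this
  omega

end Criterion

end Reisner

theorem mainTheorem1_general {V : Type*} [Fintype V] [LinearOrder V] {k : Type*} [Field k]
    (K : PreAbstractSimplicialComplex V) :
    Reisner.IsCohenMacaulay (Reisner.FaceRing k K) ↔
      ∀ σ ∈ Reisner.faceSet K, ∀ i < Reisner.dim (Reisner.link K σ),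
        CategoryTheory.Limits.IsZero (Reisner.reducedHomology k (Reisner.link K σ) i) :=
  (Reisner.isCohenMacaulay_iff_linksAcyclic (Reisner.isLowerSet_faceSet K)
    ⟨∅, Set.mem_insert _ _⟩).trans (Reisner.forall_isZero_reducedHomology_link_iff K).symm

theorem mainTheorem1 {V : Type*} [Fintype V] [LinearOrder V] {k : Type*} [Field k]
    (S : AbstractSimplicialComplex V) :
    Reisner.IsCohenMacaulay (Reisner.FaceRing k S.toPreAbstractSimplicialComplex) ↔
      (∀ σ ∈ Reisner.faceSet S.toPreAbstractSimplicialComplex,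
        ∀ i : ℤ, i < Reisner.dim (Reisner.link S.toPreAbstractSimplicialComplex σ) →
          CategoryTheory.Limits.IsZero
            (Reisner.reducedHomology k (Reisner.link S.toPreAbstractSimplicialComplex σ) i)) ∧
      (∀ i : ℤ, i < Reisner.dim S.toPreAbstractSimplicialComplex →
        CategoryTheory.Limits.IsZero
          (Reisner.reducedHomology k S.toPreAbstractSimplicialComplex i)) :=
  (mainTheorem1_general _).trans <| (and_iff_left_of_imp fun h => by
    simpa only [Reisner.link_empty] using h ∅ (Set.mem_insert _ _)).symm
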